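/- **Setting.** Let $\mathbb H=\{z\in\mathbb C:\operatorname{Im}z>0\}$ and $\overline{\mathbb H}=\{z\in\mathbb C:\operatorname{Im} z\ge 0\}$. Let $\mu_0$ be a probability measure on $\mathbb R$ with $\operatorname{supp}\mu_0\subset[-L,L]$ for some $L>0$. Let $(\mu_t)_{t\ge0}$ be a weakly continuous family of probability measures on $\mathbb R$ starting from $\mu_0$ (the hydrodynamic limit of the Dyson model) whose Green's functions $M_t(z)=\int_{\mathbb R}\frac{2\,\mu_t(du)}{z-u}$ solve the complex Burgers equation $$\frac{\partial M_t(z)}{\partial t}=-2M_t(z)\frac{\partial M_t(z)}{\partial z},\qquad t\ge0,\ z\in\mathbb C\setminus\mathbb R .$$ Let $g_t$ be the solution of the Loewner equation (the hydrodynamic limit of the multiple SLE) $$\frac{\partial g_t(z)}{\partial t}=M_t(g_t(z)),\qquad g_0(z)=z .$$ For $z\in\mathbb H$ the value $g_t(z)$ is defined as long as the solution exists and stays in $\mathbb H$; for $z\in\mathbb R$ as long as the solution exists, is real, and $g_s(z)\notin\operatorname{supp}\mu_s$ for all $0\le s\le t$. Let $D_t\subset\mathbb H$ be the set of $z\in\mathbb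 H$ for which $g_t(z)$ is defined, and let $K_t=\overline{\mathbb H\setminus D_t}$ be the hull. Put $$\mathcal K=\Bigl\{2ir\exp\Bigl(-i\varphi-\frac{e^{2i\varphi}}2\Bigr):\ -\frac\pi2\le\varphi\le\frac\pi2,\ 0\le r\le1\Bigr\}.$$ Let $W_0$ be the principal branch of the Lambert function ($W_0(x)e^{W_0(x)}=x$, $W_0(0)=0$, branch cut $(-\infty,-e^{-1}]$). For $z\in\overline{\mathbb H}\setminus\mathcal K$ let $\sqrt{W_0(-4/z^2)}$ be the square root with positive real part if $z\in\mathbb H$, extended continuously to real $z$ (so it lies on the positive imaginary axis for $z>0$ and on the negative imaginary axis for $z<0$). **Theorem.** For every such $\mu_0$ and $(\mu_t)_{t\ge0}$ and every $z\in\overline{\mathbb H}\setminus\mathcal K$, the value $g_t(\sqrt t\,z)$ is defined for all sufficiently large $t$, and $$\lim_{t\to\infty}\frac1{\sqrt t}\,g_t(\sqrt t\,z)=2i\left\{\frac1{\sqrt{W_0(-4/z^2)}}-\sqrt{W_0(-4/z^2)}\right\}.$$ Moreover the hull grows like $\sqrt t\,\mathcal K$: for every $z\in\overline{\mathbb H}\setminus\mathcal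 K$ one has $\sqrt t\,z\notin K_t$ for all sufficiently large $t$, and for every $z$ in the interior of $\mathcal K$ one has $\sqrt t\,z\in K_t$ for all sufficiently large $t$. -/

import Mathlib

open Filter Topology MeasureTheory Set

noncomputable section

namespace MultipleSLE

/-- The Green's function (resolvent) `M(z) = ∫ 2 ν(du) / (z - u)` of a measure `ν` on `ℝ`. -/
def greenFn (ν : Measure ℝ) (z : ℂ) : ℂ := ∫ u : ℝ, 2 / (z - (u : ℂ)) ∂ν

/-- `μ` is the hydrodynamic limit of the Dyson model started from `μ₀`: a weakly continuous flow of
probability measures on `ℝ`, indexed by `t ≥ 0` (the values at `t < 0` play no role), with value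
`μ₀` at time `0`, whose Green's functions `M t z` solve the complex Burgers equation
`∂M/∂t = -2 M ∂M/∂z` on `ℂ \ ℝ`. The time derivative at `t = 0` is one-sided. -/
structure IsHydrodynamicLimit (μ₀ : ProbabilityMeasure ℝ) (μ : ℝ → ProbabilityMeasure ℝ) :
    Prop where
  initial : μ 0 = μ₀
  continuousOn : ContinuousOn μ (Ici 0)
  burgers : ∀ t : ℝ, 0 ≤ t → ∀ z : ℂ, z.im ≠ 0 →
    HasDerivWithinAt (fun s : ℝ => greenFn (μ s : Measure ℝ) z)
      (-2 * greenFn (μ t : Measure ℝ) z * deriv (greenFn (μ t : Measure ℝ)) z) (Ici 0) t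

/-- `γ` solves the Loewner equation `γ' s = M s (γ s)`, `γ 0 = z`, on the time interval `[0, T]`.
A solution started in the open upper half-plane has to stay there up to time `T`; a solution
started on the real line has to stay on it and to avoid the support of `μ s` at every time `s`. -/
structure IsLoewnerPath (μ : ℝ → ProbabilityMeasure ℝ) (z : ℂ) (T : ℝ) (γ : ℝ → ℂ) : Prop where
  im_start : 0 ≤ z.im
  initial : γ 0 = z
  ode : ∀ s ∈ Icc 0 T, HasDerivWithinAt γ (greenFn (μ s : Measure ℝ) (γ s)) (Icc 0 T) s
  upper : 0 < z.im → ∀ s ∈ Icc 0 T, 0 < (γ s).im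
  real : z.im = 0 → ∀ s ∈ Icc 0 T, (γ s).im = 0 ∧ (γ s).re ∉ (μ s : Measure ℝ).support

/-- The points of the closed upper half-plane from which the Loewner equation is solvable up to
time `t`. Its points with positive imaginary part form the domain `D t` of the map `g t`; its real
points are those to which `g t` extends through the equation. -/
def loewnerDomain (μ : ℝ → ProbabilityMeasure ℝ) (t : ℝ) : Set ℂ :=
  {z | ∃ γ : ℝ → ℂ, IsLoewnerPath μ z t γ}

open Classical in
/-- The map `g t` of the Loewner chain: the value at time `t` of the solution started at `z`
(and `0`, by convention, outside `loewnerDomain μ t`). -/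
def loewnerMap (μ : ℝ → ProbabilityMeasure ℝ) (t : ℝ) (z : ℂ) : ℂ :=
  if h : ∃ γ : ℝ → ℂ, IsLoewnerPath μ z t γ then h.choose t else 0

/-- The hull `K t`, the closure of the complement of the domain of `g t` in the open upper
half-plane. -/
def hull (μ : ℝ → ProbabilityMeasure ℝ) (t : ℝ) : Set ℂ :=
  closure ({z : ℂ | 0 < z.im} \ loewnerDomain μ t)

/-- The universal shape `𝒦`. -/
def universalHull : Set ℂ :=
  {z | ∃ r φ : ℝ, r ∈ Icc (0 : ℝ) 1 ∧ φ ∈ Icc (-(Real.pi / 2)) (Real.pi / 2) ∧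
    z = 2 * Complex.I * r *
      Complex.exp (-(Complex.I * φ) - Complex.exp (2 * Complex.I * φ) / 2)}

/-- The range of the principal branch of the Lambert function. For `w = ξ + i η` off the real line
the condition `-π < η + arg w ≤ π` says that `|η| < π` and that `w` lies to the right of the curve
`ξ = - η cot η` (the upper half of the curve, the image of the upper side of the branch cut, is
included); on the real line the range is `[-1, ∞)`. -/
def lambertRange : Set ℂ :=
  {w | w.im + w.arg ∈ Ioc (-Real.pi) Real.pi ∧ (w.im = 0 → -1 ≤ w.re)}

open Classical in
/-- The principal branch `W₀` of the Lambert function, with branch cut `(-∞, -1/e]`: the solution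
`w` of `w e ^ w = z` in the range of the principal branch. -/
def lambertW0 (z : ℂ) : ℂ :=
  if h : ∃ w ∈ lambertRange, w * Complex.exp w = z then h.choose else 0

open Classical in
/-- The square root of `W₀(-4 / z ^ 2)` for `z` in the closed upper half-plane, outside `𝒦`. For
`z` in the open half-plane it is the root with positive real part, the branch for which
`√(-z ^ 2) = -i z`; on the real line it is the continuous extension of this branch, which is the
root on the positive imaginary axis for `z > 0` and the one on the negative imaginary axis
for `z < 0`. -/
def sqrtLambert (z : ℂ) : ℂ :=
  if z.im = 0 ∧ z.re < 0 then -(lambertW0 (-4 / z ^ 2)) ^ (1 / 2 : ℂ)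
  else lambertW0 (-4 / z ^ 2) ^ (1 / 2 : ℂ)

end MultipleSLE

end

noncomputable section

namespace MultipleSLE

/-! The Burgers equation keeps the Green's function constant along the straight lines $s\mapsto
x+2sM_0(x)$. Writing a Loewner trajectory as $\gamma_s=\zeta_s+2sM_0(\zeta_s)$ therefore removes
$\mu_s$: the Loewner equation becomes $\zeta'=$ `charField μ₀ s ζ`, an equation that involves the
initial measure only. Dividing space by $\sqrt t$ and time by $t$ replaces $\mu_0$ by a measure on
$[-L/\sqrt t,L/\sqrt t]$, so the limit is governed by the point mass at $0$.

For the point mass the equation is explicit. With $w=-4\sigma/Y^2$ one has $we^w=\sigma(-4/z^2)$ and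
$Y=ze^{w/2}$; at $\sigma=1$ this reads $z=Ye^{2/Y^2}$, the position is $Y+4/Y$, and $2i/Y$ is the
prescribed root of $W_0(-4/z^2)$, which gives the formula (`exists_limitPath`, `sqrtLambert_eq`).

The threshold is $|Y|>2\sqrt\sigma$, that is $|w|<1$. It makes $2sM_0$ a contraction and keeps the
field regular. The solution $w$ can be continued in $\sigma$ unless $|w|$ reaches $1$, which would
put $z$ in $\mathcal K$ (`exists_lambert`). Outside $\mathcal K$ the path has a positive margin, so
it survives small changes of the measure and of the starting point (`exists_charField_path`). This
gives the convergence, and a domain neighbourhood of uniform rescaled size, as the closure in the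
hull demands. For real starting points one also needs that real characteristics avoid
$\operatorname{supp}\mu_s$ (`real_characteristic`).

Inside $\mathcal K$ a conserved quantity replaces the analysis of the equation:
$sM_0(\zeta_s)^2+\Phi(\zeta_s)$ is constant, where $\Phi'=M_0$. If $\sqrt t\,z$ survives until time
$t$ and $\zeta_t=\sqrt t\,y$, positivity of $\operatorname{Im}\gamma_t$ forces $|y|\ge2-o(1)$, and
conservation gives $ye^{2/y^2}=z(1+o(1))$. A limit point $a$ has $|a|\ge2$ and `outerMap a = z`, but
`outerMap` sends such points outside the interior of $\mathcal K$ (`outerMap_notMem_interior`). -/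

/-- `ν`-almost every point has distance at least `d` from `z`. -/
def FarFrom (ν : Measure ℝ) (d : ℝ) (z : ℂ) : Prop := ∀ᵐ u : ℝ ∂ν, d ≤ ‖z - (u : ℂ)‖

/-- The squared Cauchy kernel, integrated: `-(greenFn ν)'`. -/
def cauchySq (ν : Measure ℝ) (z : ℂ) : ℂ := ∫ u : ℝ, 2 / (z - (u : ℂ)) ^ 2 ∂ν

/-- The Poisson-type integral governing the imaginary part of `greenFn`. -/
def poissonInt (ν : Measure ℝ) (z : ℂ) : ℝ := ∫ u : ℝ, 2 / ‖z - (u : ℂ)‖ ^ 2 ∂ν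

/-! ### Cauchy and Poisson integrals at a distance from the measure -/

section Kernels

variable {ν : Measure ℝ} {d : ℝ} {z a b : ℂ}

lemma FarFrom.mono {d' : ℝ} (h : FarFrom ν d z) (hd : d' ≤ d) : FarFrom ν d' z :=
  Eventually.mono h fun _ hu => hd.trans hu

lemma FarFrom.of_dist {r : ℝ} (h : FarFrom ν d a) (hab : ‖b - a‖ ≤ r) :
    FarFrom ν (d - r) b := by
  filter_upwards [h] with u hu
  have : ‖a - (u : ℂ)‖ ≤ ‖b - a‖ + ‖b - (u : ℂ)‖ := by
    calc ‖a - (u : ℂ)‖ = ‖(b - (u : ℂ)) - (b - a)‖ := by congr 1; ring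
      _ ≤ ‖b - (u : ℂ)‖ + ‖b - a‖ := norm_sub_le _ _
      _ = _ := add_comm _ _
  linarith

lemma farFrom_im (ν : Measure ℝ) (z : ℂ) : FarFrom ν |z.im| z := by
  refine Eventually.of_forall fun u => ?_
  simpa using Complex.abs_im_le_norm (z - (u : ℂ))

lemma norm_inv_le (hd : 0 < d) {u : ℝ} (h : d ≤ ‖z - (u : ℂ)‖) : ‖(z - (u : ℂ))⁻¹‖ ≤ d⁻¹ := by
  rw [norm_inv]; exact inv_anti₀ hd h

lemma sub_ne_zero_of_far (hd : 0 < d) {u : ℝ} (h : d ≤ ‖z - (u : ℂ)‖) : z - (u : ℂ) ≠ 0 := by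
  intro h0; rw [h0, norm_zero] at h; linarith

lemma inv_sub_inv_kernel {u : ℝ} (ha : a - (u : ℂ) ≠ 0) (hb : b - (u : ℂ) ≠ 0) :
    (a - (u : ℂ))⁻¹ - (b - (u : ℂ))⁻¹ = (b - a) * (a - (u : ℂ))⁻¹ * (b - (u : ℂ))⁻¹ := by
  field_simp; ring

variable [IsProbabilityMeasure ν]

lemma norm_integral_le_of_ae_le {f : ℝ → ℂ} {C : ℝ} (h : ∀ᵐ u ∂ν, ‖f u‖ ≤ C) :
    ‖∫ u, f u ∂ν‖ ≤ C := by
  simpa using norm_integral_le_of_norm_le_const h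

lemma integrable_kernel (hd : 0 < d) (h : FarFrom ν d z) :
    Integrable (fun u : ℝ => 2 / (z - (u : ℂ))) ν := by
  refine Integrable.of_bound (C := 2 * d⁻¹) (Measurable.aestronglyMeasurable (by fun_prop)) ?_
  filter_upwards [h] with u hu
  rw [div_eq_mul_inv, norm_mul]
  simpa using norm_inv_le hd hu

lemma integrable_kernel_sq (hd : 0 < d) (h : FarFrom ν d z) :
    Integrable (fun u : ℝ => 2 / (z - (u : ℂ)) ^ 2) ν := by
  refine Integrable.of_bound (C := 2 * (d⁻¹) ^ 2) (Measurable.aestronglyMeasurable (by fun_prop)) ?_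
  filter_upwards [h] with u hu
  rw [div_eq_mul_inv, norm_mul, ← inv_pow, norm_pow]
  have := norm_inv_le hd hu
  have := pow_le_pow_left₀ (norm_nonneg _) this 2
  simpa using this

lemma norm_greenFn_le (hd : 0 < d) (h : FarFrom ν d z) : ‖greenFn ν z‖ ≤ 2 / d := by
  refine norm_integral_le_of_ae_le ?_
  filter_upwards [h] with u hu
  rw [norm_div]; simp only [Complex.norm_ofNat]; gcongr

lemma norm_cauchySq_le (hd : 0 < d) (h : FarFrom ν d z) : ‖cauchySq ν z‖ ≤ 2 / d ^ 2 := by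
  refine norm_integral_le_of_ae_le ?_
  filter_upwards [h] with u hu
  rw [norm_div, norm_pow]; simp only [Complex.norm_ofNat]; gcongr

lemma norm_greenFn_sub_le (hd : 0 < d) (ha : FarFrom ν d a) (hb : FarFrom ν d b) :
    ‖greenFn ν a - greenFn ν b‖ ≤ 2 / d ^ 2 * ‖a - b‖ := by
  rw [greenFn, greenFn, ← integral_sub (integrable_kernel hd ha) (integrable_kernel hd hb)]
  refine norm_integral_le_of_ae_le ?_
  filter_upwards [ha, hb] with u hu hv
  have e : 2 / (a - (u : ℂ)) - 2 / (b - (u : ℂ))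
      = 2 * ((b - a) * (a - (u : ℂ))⁻¹ * (b - (u : ℂ))⁻¹) := by
    rw [← inv_sub_inv_kernel (sub_ne_zero_of_far hd hu) (sub_ne_zero_of_far hd hv)]; ring
  rw [e, norm_mul, norm_mul, norm_mul, norm_sub_rev b a]
  have h1 := norm_inv_le hd hu
  have h2 := norm_inv_le hd hv
  calc ‖(2 : ℂ)‖ * (‖a - b‖ * ‖(a - (u : ℂ))⁻¹‖ * ‖(b - (u : ℂ))⁻¹‖)
      ≤ ‖(2 : ℂ)‖ * (‖a - b‖ * d⁻¹ * d⁻¹) := by gcongr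
    _ = _ := by simp; field_simp

lemma norm_cauchySq_sub_le (hd : 0 < d) (ha : FarFrom ν d a) (hb : FarFrom ν d b) :
    ‖cauchySq ν a - cauchySq ν b‖ ≤ 4 / d ^ 3 * ‖a - b‖ := by
  rw [cauchySq, cauchySq, ← integral_sub (integrable_kernel_sq hd ha) (integrable_kernel_sq hd hb)]
  refine norm_integral_le_of_ae_le ?_
  filter_upwards [ha, hb] with u hu hv
  have e : 2 / (a - (u : ℂ)) ^ 2 - 2 / (b - (u : ℂ)) ^ 2
      = 2 * (((b - a) * (a - (u : ℂ))⁻¹ * (b - (u : ℂ))⁻¹)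
        * ((a - (u : ℂ))⁻¹ + (b - (u : ℂ))⁻¹)) := by
    rw [← inv_sub_inv_kernel (sub_ne_zero_of_far hd hu) (sub_ne_zero_of_far hd hv)]
    simp only [div_eq_mul_inv, ← inv_pow]; ring
  rw [e, norm_mul, norm_mul, norm_mul, norm_mul, norm_sub_rev b a]
  have h1 := norm_inv_le hd hu
  have h2 := norm_inv_le hd hv
  have h3 : ‖(a - (u : ℂ))⁻¹ + (b - (u : ℂ))⁻¹‖ ≤ d⁻¹ + d⁻¹ :=
    (norm_add_le _ _).trans (add_le_add h1 h2)
  calc ‖(2 : ℂ)‖ * (‖a - b‖ * ‖(a - (u : ℂ))⁻¹‖ * ‖(b - (u : ℂ))⁻¹‖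
        * ‖(a - (u : ℂ))⁻¹ + (b - (u : ℂ))⁻¹‖)
      ≤ ‖(2 : ℂ)‖ * (‖a - b‖ * d⁻¹ * d⁻¹ * (d⁻¹ + d⁻¹)) := by gcongr
    _ = _ := by simp; field_simp; ring

/-- The remainder bound does not depend on the measure. This gives the complex derivative and also
the chain rule in time, where the measure moves together with the point. -/
lemma norm_greenFn_taylor_le (hd : 0 < d) (ha : FarFrom ν d a) (hb : FarFrom ν d b) :
    ‖greenFn ν a - greenFn ν b + (a - b) * cauchySq ν b‖ ≤ 2 / d ^ 3 * ‖a - b‖ ^ 2 := by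
  rw [greenFn, greenFn, cauchySq, ← integral_const_mul,
    ← integral_sub (integrable_kernel hd ha) (integrable_kernel hd hb),
    ← integral_add (f := fun u : ℝ => 2 / (a - (u : ℂ)) - 2 / (b - (u : ℂ)))
      ((integrable_kernel hd ha).sub (integrable_kernel hd hb))
      ((integrable_kernel_sq hd hb).const_mul _)]
  refine norm_integral_le_of_ae_le ?_
  filter_upwards [ha, hb] with u hu hv
  have e : 2 / (a - (u : ℂ)) - 2 / (b - (u : ℂ)) + (a - b) * (2 / (b - (u : ℂ)) ^ 2)
      = 2 * ((a - b) ^ 2 * ((a - (u : ℂ))⁻¹ * (b - (u : ℂ))⁻¹ ^ 2)) := by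
    have h1 := sub_ne_zero_of_far hd hu
    have h2 := sub_ne_zero_of_far hd hv
    field_simp; ring
  rw [e, norm_mul, norm_mul, norm_mul, norm_pow, norm_pow]
  have h1 := norm_inv_le hd hu
  have h2 := norm_inv_le hd hv
  calc ‖(2 : ℂ)‖ * (‖a - b‖ ^ 2 * (‖(a - (u : ℂ))⁻¹‖ * ‖(b - (u : ℂ))⁻¹‖ ^ 2))
      ≤ ‖(2 : ℂ)‖ * (‖a - b‖ ^ 2 * (d⁻¹ * d⁻¹ ^ 2)) := by gcongr
    _ = _ := by simp; field_simp

lemma hasDerivAt_greenFn (hd : 0 < d) (h : FarFrom ν d z) :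
    HasDerivAt (greenFn ν) (-cauchySq ν z) z := by
  rw [hasDerivAt_iff_isLittleO]
  refine Asymptotics.IsBigO.trans_isLittleO (g := fun w => (w - z) ^ 2) ?_ ?_
  · refine Asymptotics.IsBigO.of_bound (2 / (d / 2) ^ 3) ?_
    filter_upwards [Metric.closedBall_mem_nhds z (half_pos hd)] with w hw
    rw [Metric.mem_closedBall, dist_eq_norm] at hw
    have := norm_greenFn_taylor_le (half_pos hd) (a := w) (b := z)
      ((h.of_dist hw).mono (by linarith)) (h.mono (by linarith))
    rw [norm_pow]
    refine le_trans (le_of_eq (congrArg _ ?_)) this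
    rw [smul_eq_mul]; ring
  · have := Asymptotics.isLittleO_pow_id (𝕜 := ℂ) (n := 2) one_lt_two
    have h2 : Tendsto (fun w => w - z) (𝓝 z) (𝓝 0) := by
      exact (continuous_id.sub continuous_const).tendsto' z 0 (sub_self z)
    exact this.comp_tendsto h2

lemma deriv_greenFn (hz : z.im ≠ 0) : deriv (greenFn ν) z = -cauchySq ν z :=
  (hasDerivAt_greenFn (abs_pos.2 hz) (farFrom_im ν z)).deriv

lemma integrable_poisson (hd : 0 < d) (h : FarFrom ν d z) :
    Integrable (fun u : ℝ => 2 / ‖z - (u : ℂ)‖ ^ 2) ν := by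
  refine Integrable.of_bound (C := 2 / d ^ 2) (Measurable.aestronglyMeasurable (by fun_prop)) ?_
  filter_upwards [h] with u hu
  rw [norm_div, norm_pow]; simp only [Real.norm_ofNat, norm_norm]; gcongr

lemma greenFn_im (hd : 0 < d) (h : FarFrom ν d z) :
    (greenFn ν z).im = -z.im * poissonInt ν z := by
  have e := integral_im (𝕜 := ℂ) (integrable_kernel hd h)
  have e' : (greenFn ν z).im = ∫ u : ℝ, (2 / (z - (u : ℂ))).im ∂ν := e.symm
  rw [e', poissonInt, ← integral_const_mul]
  congr 1; ext u
  rw [Complex.div_im, ← Complex.normSq_eq_norm_sq]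
  simp; ring

lemma poissonInt_nonneg (ν : Measure ℝ) (z : ℂ) : 0 ≤ poissonInt ν z :=
  integral_nonneg fun u => by positivity

lemma poissonInt_le (hd : 0 < d) (h : FarFrom ν d z) : poissonInt ν z ≤ 2 / d ^ 2 := by
  have := norm_integral_le_of_norm_le_const (μ := ν) (f := fun u : ℝ => 2 / ‖z - (u : ℂ)‖ ^ 2)
    (C := 2 / d ^ 2) (by
      filter_upwards [h] with u hu
      rw [norm_div, norm_pow]; simp only [Real.norm_ofNat, norm_norm]; gcongr)
  simpa [poissonInt] using (le_abs_self _).trans this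

lemma le_poissonInt {D : ℝ} (hd : 0 < d) (h : FarFrom ν d z)
    (hD : ∀ᵐ u : ℝ ∂ν, ‖z - (u : ℂ)‖ ≤ D) : 2 / D ^ 2 ≤ poissonInt ν z := by
  have : ∫ _u : ℝ, 2 / D ^ 2 ∂ν ≤ poissonInt ν z := by
    refine integral_mono_ae (integrable_const _) (integrable_poisson hd h) ?_
    filter_upwards [h, hD] with u hu hv
    have : 0 < ‖z - (u : ℂ)‖ := hd.trans_le hu
    gcongr
  simpa using this

end Kernels

/-- Grönwall's inequality forwards from `r₀` and, after reversing time, backwards. The backward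
direction is needed to trace a characteristic to time `0` and to show that an imaginary part which
vanishes once vanishes always. -/
lemma eq_zero_of_norm_deriv_le {E : Type*} [NormedAddCommGroup E] [NormedSpace ℝ E]
    {h h' : ℝ → E} {K T r₀ : ℝ} (hr₀ : r₀ ∈ Icc 0 T) (h0 : h r₀ = 0)
    (hd : ∀ r ∈ Icc 0 T, HasDerivWithinAt h (h' r) (Icc 0 T) r)
    (hb : ∀ r ∈ Icc 0 T, ‖h' r‖ ≤ K * ‖h r‖) : ∀ r ∈ Icc 0 T, h r = 0 := by
  intro r hr
  have hc : ContinuousOn h (Icc 0 T) := fun x hx => (hd x hx).continuousWithinAt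
  rcases le_total r₀ r with hle | hle
  · refine eq_zero_of_abs_deriv_le_mul_abs_self_of_eq_zero_right (f := h) (f' := h') (K := K)
      (a := r₀) (b := T) (hc.mono (Icc_subset_Icc_left hr₀.1)) (fun x hx => ?_) h0
      (fun x hx => hb x ⟨hr₀.1.trans hx.1, hx.2.le⟩) r ⟨hle, hr.2⟩
    exact (hd x ⟨hr₀.1.trans hx.1, hx.2.le⟩).mono_of_mem_nhdsWithin
      (mem_of_superset (Icc_mem_nhdsGE hx.2)
        (Icc_subset_Icc_left (hr₀.1.trans hx.1)))
  · have hmap : MapsTo (fun x => r₀ - x) (Icc 0 r₀) (Icc 0 T) := fun x hx =>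
      ⟨by linarith [hx.2], by linarith [hx.1, hr₀.2]⟩
    have key := eq_zero_of_abs_deriv_le_mul_abs_self_of_eq_zero_right
      (f := fun x => h (r₀ - x)) (f' := fun x => -h' (r₀ - x)) (K := K)
      (a := 0) (b := r₀) (hc.comp (by fun_prop) hmap) (fun x hx => ?_) (by simpa using h0)
      (fun x hx => by rw [norm_neg]; exact hb _ (hmap ⟨hx.1, hx.2.le⟩)) (r₀ - r)
      ⟨by linarith, by linarith [hr.1]⟩
    · simpa using key
    · have h1 := (hd (r₀ - x) (hmap ⟨hx.1, hx.2.le⟩))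
      have h2 : HasDerivWithinAt (fun x => r₀ - x) (-1) (Icc 0 r₀) x := by
        simpa using (hasDerivWithinAt_id x (Icc 0 r₀)).const_sub r₀
      have h3 := h1.scomp x h2 hmap
      simp only [neg_smul, one_smul] at h3
      exact h3.mono_of_mem_nhdsWithin (mem_of_superset (Icc_mem_nhdsGE hx.2)
        (Icc_subset_Icc_left hx.1))

/-! ### Characteristics of the Burgers equation -/

section Flow

variable {μ₀ : ProbabilityMeasure ℝ} {μ : ℝ → ProbabilityMeasure ℝ}

/-- Off the real line the kernel is a bounded continuous test function, so weak continuity of the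
flow applies. -/
lemma tendsto_cauchySq (hμ : IsHydrodynamicLimit μ₀ μ) {s : ℝ} (hs : 0 ≤ s) {w : ℂ}
    (hw : w.im ≠ 0) :
    Tendsto (fun r => cauchySq (μ r : Measure ℝ) w) (𝓝[Ici 0] s)
      (𝓝 (cauchySq (μ s : Measure ℝ) w)) := by
  have hne : ∀ u : ℝ, w - (u : ℂ) ≠ 0 := fun u h => hw (by simpa using congrArg Complex.im h)
  let f : BoundedContinuousFunction ℝ ℂ :=
    BoundedContinuousFunction.ofNormedAddCommGroup (fun u : ℝ => 2 / (w - (u : ℂ)) ^ 2)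
      (by
        refine Continuous.div₀ (by fun_prop) (by fun_prop) fun u => pow_ne_zero 2 (hne u))
      (2 / |w.im| ^ 2) (fun u => by
        have := Complex.abs_im_le_norm (w - (u : ℂ))
        simp only [Complex.sub_im, Complex.ofReal_im, sub_zero] at this
        have h0 := abs_pos.2 hw
        rw [norm_div, norm_pow]; simp only [Complex.norm_ofNat]; gcongr)
  exact ((ProbabilityMeasure.tendsto_iff_forall_integral_rclike_tendsto ℂ).1
    (hμ.continuousOn s hs)) f

/-- The chain rule for the Green's functions along a moving point. -/
lemma hasDerivWithinAt_greenFn_comp (hμ : IsHydrodynamicLimit μ₀ μ) {S : Set ℝ} (hS : S ⊆ Ici 0)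
    {γ : ℝ → ℂ} {γ' : ℂ} {s : ℝ} (hs : s ∈ S) (hγ : HasDerivWithinAt γ γ' S s)
    (him : (γ s).im ≠ 0) :
    HasDerivWithinAt (fun r => greenFn (μ r : Measure ℝ) (γ r))
      (cauchySq (μ s : Measure ℝ) (γ s) * (2 * greenFn (μ s : Measure ℝ) (γ s) - γ')) S s := by
  set d : ℝ := |(γ s).im| with hd
  have hd0 : 0 < d := abs_pos.2 him
  -- The Taylor remainder is of order $(\gamma_r-\gamma_s)^2=O((r-s)^2)$ uniformly in the measures
  -- `μ r`, hence has derivative zero.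
  have h1 : HasDerivWithinAt (fun r => greenFn (μ r : Measure ℝ) (γ r)
      - greenFn (μ r : Measure ℝ) (γ s) + (γ r - γ s) * cauchySq (μ r : Measure ℝ) (γ s)) 0 S s := by
    rw [hasDerivWithinAt_iff_isLittleO]
    simp only [sub_self, zero_mul, add_zero, sub_zero, smul_zero]
    have hO : (fun r => greenFn (μ r : Measure ℝ) (γ r)
      - greenFn (μ r : Measure ℝ) (γ s) + (γ r - γ s) * cauchySq (μ r : Measure ℝ) (γ s))
        =O[𝓝[S] s] fun r => (γ r - γ s) ^ 2 := by
      refine Asymptotics.IsBigO.of_bound (2 / (d / 2) ^ 3) ?_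
      have : ∀ᶠ r in 𝓝[S] s, γ r ∈ Metric.closedBall (γ s) (d / 2) :=
        hγ.continuousWithinAt.tendsto (Metric.closedBall_mem_nhds _ (half_pos hd0))
      filter_upwards [this] with r hr
      rw [Metric.mem_closedBall, dist_eq_norm] at hr
      have h := farFrom_im (μ r : Measure ℝ) (γ s)
      rw [norm_pow]
      exact norm_greenFn_taylor_le (half_pos hd0) ((h.of_dist hr).mono (by rw [← hd]; linarith))
        (h.mono (by rw [← hd]; linarith))
    have hO2 : (fun r => γ r - γ s) =O[𝓝[S] s] fun r => r - s :=
      (HasDerivAtFilter.isBigO_sub hγ).comp_tendsto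
        (tendsto_id.prodMk tendsto_const_pure)
    have ht : Tendsto (fun r : ℝ => r - s) (𝓝[S] s) (𝓝 0) :=
      ((continuous_id.sub continuous_const).tendsto' s 0 (sub_self s)).mono_left nhdsWithin_le_nhds
    exact (hO.trans (hO2.pow 2)).trans_isLittleO
      ((Asymptotics.isLittleO_pow_id (𝕜 := ℝ) (n := 2) one_lt_two).comp_tendsto ht)
  have h2 := (hμ.burgers s (hS hs) (γ s) him).mono hS
  rw [deriv_greenFn him] at h2
  -- The first factor vanishes at `s`, so mere continuity of the second factor in `r` suffices.
  have h3 : HasDerivWithinAt (fun r => (γ r - γ s) * cauchySq (μ r : Measure ℝ) (γ s))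
      (γ' * cauchySq (μ s : Measure ℝ) (γ s)) S s := by
    rw [hasDerivWithinAt_iff_tendsto_slope] at hγ ⊢
    have h4 : Tendsto (fun r => cauchySq (μ r : Measure ℝ) (γ s)) (𝓝[S \ {s}] s)
        (𝓝 (cauchySq (μ s : Measure ℝ) (γ s))) :=
      (tendsto_cauchySq hμ (hS hs) him).mono_left (nhdsWithin_mono _ (sdiff_subset.trans hS))
    refine (hγ.mul h4).congr fun r => ?_
    simp only [slope, vsub_eq_sub, sub_self, zero_mul, sub_zero]
    simp only [smul_mul_assoc]
  have h5 := (h1.add h2).sub h3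
  refine (h5.congr_deriv ?_).congr_of_eventuallyEq (Eventually.of_forall fun r => ?_) ?_
  · ring
  · simp only [Pi.add_apply, Pi.sub_apply]; ring
  · simp only [Pi.add_apply, Pi.sub_apply]; ring

/-- The Green's function is constant along the characteristics of the Burgers equation. -/
lemma greenFn_characteristic (hμ : IsHydrodynamicLimit μ₀ μ) {a b : ℂ} {T r₀ : ℝ}
    (hr₀ : r₀ ∈ Icc 0 T) (ha : 0 < a.im) (hb : 0 < (a + 2 * T * b).im)
    (h : greenFn (μ r₀ : Measure ℝ) (a + 2 * r₀ * b) = b) :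
    ∀ r ∈ Icc 0 T, greenFn (μ r : Measure ℝ) (a + 2 * r * b) = b := by
  -- The imaginary part is affine in `r`, so it is at least the smaller of its two end values.
  have hpos : ∀ r ∈ Icc 0 T, min a.im (a + 2 * T * b).im ≤ (a + 2 * r * b).im := by
    intro r hr
    have e : ∀ x : ℝ, (a + 2 * x * b).im = a.im + 2 * x * b.im := fun x => by simp
    rw [e, e]
    rcases le_total 0 b.im with h0 | h0
    · exact min_le_of_left_le (by nlinarith [hr.1])
    · exact min_le_of_right_le (by nlinarith [hr.2])
  set c := min a.im (a + 2 * T * b).im with hc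
  have hc0 : 0 < c := lt_min ha hb
  -- Along a line of velocity $2b$ the chain rule gives $\frac{d}{dr}(M-b)=2\,$`cauchySq`$\,(M-b)$,
  -- a linear homogeneous equation.
  have key := eq_zero_of_norm_deriv_le (E := ℂ)
    (h := fun r => greenFn (μ r : Measure ℝ) (a + 2 * r * b) - b)
    (h' := fun r => cauchySq (μ r : Measure ℝ) (a + 2 * r * b) *
      (2 * greenFn (μ r : Measure ℝ) (a + 2 * r * b) - 2 * b)) (K := 2 / c ^ 2 * 2) hr₀
    (by simp [h]) ?_ ?_
  · intro r hr
    exact sub_eq_zero.1 (key r hr)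
  · intro r hr
    refine (hasDerivWithinAt_greenFn_comp hμ Icc_subset_Ici_self hr
      (γ := fun r : ℝ => a + 2 * r * b) ?_ (hc0.trans_le (hpos r hr)).ne').sub_const b
    have : HasDerivAt (fun r : ℝ => a + 2 * (r : ℂ) * b) (2 * 1 * b) r :=
      (((Complex.ofRealCLM.hasDerivAt (x := r)).const_mul (2 : ℂ)).mul_const b).const_add a
    simpa using this.hasDerivWithinAt
  · intro r hr
    rw [← mul_sub, norm_mul, norm_mul]
    have := norm_cauchySq_le (ν := (μ r : Measure ℝ)) hc0
      ((farFrom_im _ (a + 2 * r * b)).mono ((hpos r hr).trans (le_abs_self _)))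
    calc _ ≤ 2 / c ^ 2 * (‖(2 : ℂ)‖ * ‖greenFn (μ r : Measure ℝ) (a + 2 * r * b) - b‖) := by gcongr
      _ = _ := by simp; ring

end Flow

/-! ### Inverting the characteristic map -/

/-- The time-`s` position of the characteristic of the Burgers equation issued from `x`. -/
def charMap (ν : Measure ℝ) (s : ℝ) (x : ℂ) : ℂ := x + 2 * s * greenFn ν x

/-- This is the source of the threshold $2\sqrt s$: at distance $d$ the map $2sM$ has Lipschitz
constant $4s/d^2$, which is below $1$ exactly for $d>2\sqrt s$; the margin `κ` gives a quantitative
gap. -/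
lemma four_mul_div_sq_le {s κ : ℝ} (hs : 0 ≤ s) (hκ : 0 < κ) :
    2 * s * (2 / (2 * √s + κ) ^ 2) ≤ 1 - κ / (2 * √s + κ) := by
  have h1 : 0 ≤ √s := Real.sqrt_nonneg s
  have hD : 0 < 2 * √s + κ := by linarith
  have e : 1 - κ / (2 * √s + κ) = 2 * √s * (2 * √s + κ) / (2 * √s + κ) ^ 2 := by
    field_simp; ring
  have e2 : 2 * s * (2 / (2 * √s + κ) ^ 2) = 4 * s / (2 * √s + κ) ^ 2 := by ring
  rw [e, e2]
  refine div_le_div_of_nonneg_right ?_ (by positivity)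
  nlinarith [Real.sq_sqrt hs, mul_nonneg h1 hκ.le]

section

variable {ν : Measure ℝ} [IsProbabilityMeasure ν] {s κ : ℝ} {x y ζ w : ℂ}

lemma greenFn_contract (hs : 0 ≤ s) (hκ : 0 < κ) (hx : FarFrom ν (2 * √s + κ) x)
    (hy : FarFrom ν (2 * √s + κ) y) :
    ‖2 * (s : ℂ) * greenFn ν x - 2 * s * greenFn ν y‖ ≤ (1 - κ / (2 * √s + κ)) * ‖x - y‖ := by
  have hD : 0 < 2 * √s + κ := by positivity
  have h := norm_greenFn_sub_le hD hx hy
  rw [← mul_sub, norm_mul]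
  have e : ‖2 * (s : ℂ)‖ = 2 * s := by simp [abs_of_nonneg hs]
  rw [e]
  calc 2 * s * ‖greenFn ν x - greenFn ν y‖
      ≤ 2 * s * (2 / (2 * √s + κ) ^ 2 * ‖x - y‖) := by gcongr
    _ = 2 * s * (2 / (2 * √s + κ) ^ 2) * ‖x - y‖ := by ring
    _ ≤ _ := by gcongr; exact four_mul_div_sq_le hs hκ

lemma norm_sub_le_charMap (hs : 0 ≤ s) (hκ : 0 < κ) (hx : FarFrom ν (2 * √s + κ) x)
    (hy : FarFrom ν (2 * √s + κ) y) :
    κ / (2 * √s + κ) * ‖x - y‖ ≤ ‖charMap ν s x - charMap ν s y‖ := by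
  have h := greenFn_contract hs hκ hx hy
  have e : x - y = (charMap ν s x - charMap ν s y)
      - (2 * (s : ℂ) * greenFn ν x - 2 * s * greenFn ν y) := by simp only [charMap]; ring
  have h2 : ‖x - y‖ ≤ ‖charMap ν s x - charMap ν s y‖
      + ‖2 * (s : ℂ) * greenFn ν x - 2 * s * greenFn ν y‖ := by
    conv_lhs => rw [e]
    exact norm_sub_le _ _
  linarith

lemma charMap_im (hκ : 0 < κ) (hx : FarFrom ν (2 * √s + κ) x) :
    (charMap ν s x).im = x.im * (1 - 2 * s * poissonInt ν x) := by
  have hD : 0 < 2 * √s + κ := by positivity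
  simp only [charMap, Complex.add_im]
  have : (2 * (s : ℂ) * greenFn ν x).im = 2 * s * (greenFn ν x).im := by simp
  rw [this, greenFn_im hD hx]; ring

lemma le_one_sub_poissonInt (hs : 0 ≤ s) (hκ : 0 < κ) (hx : FarFrom ν (2 * √s + κ) x) :
    κ / (2 * √s + κ) ≤ 1 - 2 * s * poissonInt ν x := by
  have hD : 0 < 2 * √s + κ := by positivity
  have h1 := poissonInt_le hD hx
  have h2 := four_mul_div_sq_le hs hκ
  have h3 : 2 * s * poissonInt ν x ≤ 2 * s * (2 / (2 * √s + κ) ^ 2) := by gcongr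
  linarith

/-- Banach's fixed point theorem for $x\mapsto w-2sM(x)$ on the closed disc of radius `κ` about `ζ`.
The bound on `w` is what keeps the disc invariant. -/
lemma exists_charMap_eq (hs : 0 ≤ s) (hκ : 0 < κ) (hζ : FarFrom ν (2 * √s + 2 * κ) ζ)
    (hw : ‖w - charMap ν s ζ‖ ≤ κ / (2 * √s + κ) * κ) :
    ∃ x, ‖x - ζ‖ ≤ κ ∧ charMap ν s x = w := by
  have hD : 0 < 2 * √s + κ := by positivity
  have hfar : ∀ x ∈ Metric.closedBall ζ κ, FarFrom ν (2 * √s + κ) x := fun x hx =>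
    (hζ.of_dist (by simpa [dist_eq_norm] using hx)).mono (by linarith)
  have hθ : 0 ≤ 1 - κ / (2 * √s + κ) := by
    rw [sub_nonneg, div_le_one hD]; linarith [Real.sqrt_nonneg s]
  let f : ℂ → ℂ := fun x => w - 2 * s * greenFn ν x
  have hζm : ζ ∈ Metric.closedBall ζ κ := Metric.mem_closedBall_self hκ.le
  have hcontr : ∀ x ∈ Metric.closedBall ζ κ, ∀ y ∈ Metric.closedBall ζ κ,
      ‖f x - f y‖ ≤ (1 - κ / (2 * √s + κ)) * ‖x - y‖ := fun x hx y hy => by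
    have := greenFn_contract hs hκ (hfar y hy) (hfar x hx)
    rw [norm_sub_rev x y]
    simpa [f] using this
  have hmaps : MapsTo f (Metric.closedBall ζ κ) (Metric.closedBall ζ κ) := by
    intro x hx
    have h1 := hcontr x hx ζ hζm
    rw [Metric.mem_closedBall, dist_eq_norm] at hx ⊢
    have e : f x - ζ = (w - charMap ν s ζ) + (f x - f ζ) := by simp only [f, charMap]; ring
    rw [e]
    refine (norm_add_le _ _).trans ?_
    have : (1 - κ / (2 * √s + κ)) * ‖x - ζ‖ ≤ (1 - κ / (2 * √s + κ)) * κ := by gcongr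
    linarith
  have hc : ContractingWith (1 - κ / (2 * √s + κ)).toNNReal (hmaps.restrict f _ _) := by
    refine ⟨?_, ?_⟩
    · rw [← NNReal.coe_lt_coe, Real.coe_toNNReal _ hθ]
      have : 0 < κ / (2 * √s + κ) := by positivity
      simpa using this
    · refine LipschitzWith.of_dist_le_mul fun x y => ?_
      rw [Real.coe_toNNReal _ hθ]
      have := hcontr x x.2 y y.2
      rw [← dist_eq_norm, ← dist_eq_norm] at this
      exact this
  obtain ⟨x, hx, hfx, -⟩ := ContractingWith.exists_fixedPoint' Metric.isClosed_closedBall.isComplete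
    hmaps hc hζm (edist_ne_top _ _)
  refine ⟨x, by simpa [dist_eq_norm] using hx, ?_⟩
  have : w - 2 * s * greenFn ν x = x := hfx
  rw [charMap]; linear_combination -this

end

/-! ### Real characteristics and the support of $\mu_s$ -/

/-- A measure with bounded Poisson integrals just above a real interval does not charge it. -/
lemma farFrom_of_poissonInt_le {ν : Measure ℝ} [IsProbabilityMeasure ν] {p ρ C : ℝ} (hρ : 0 < ρ)
    (hC : ∀ x η : ℝ, |x - p| ≤ ρ → 0 < η → η ≤ ρ → poissonInt ν (x + η * Complex.I) ≤ C) :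
    FarFrom ν ρ (p : ℂ) := by
  -- Evaluated above the midpoint at height half the length, the Poisson kernel is at least
  -- $1/\eta^2$ on the interval. Hence the mass of an interval is quadratic in its length.
  have hIoc : ∀ a b : ℝ, p - ρ ≤ a → a < b → b ≤ p + ρ → ν.real (Ioc a b) ≤ C * (b - a) ^ 2 := by
    intro a b ha hab hb
    set x := (a + b) / 2 with hx
    set η := (b - a) / 2 with hη
    have hη0 : 0 < η := by rw [hη]; linarith
    have h1 := hC x η (by rw [abs_le]; constructor <;> linarith) hη0 (by linarith)
    have him : (((x : ℂ) + η * Complex.I)).im = η := by simp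
    have hfar : FarFrom ν η ((x : ℂ) + η * Complex.I) :=
      (farFrom_im ν _).mono (by rw [him]; exact le_abs_self _)
    have hint := integrable_poisson hη0 hfar
    have h2 : ∫ _u in Ioc a b, 1 / η ^ 2 ∂ν ≤
        ∫ u in Ioc a b, 2 / ‖(x : ℂ) + η * Complex.I - (u : ℂ)‖ ^ 2 ∂ν := by
      refine setIntegral_mono_on (integrable_const _).integrableOn hint.integrableOn
        measurableSet_Ioc fun u hu => ?_
      have e : ‖(x : ℂ) + η * Complex.I - (u : ℂ)‖ ^ 2 = (x - u) ^ 2 + η ^ 2 := by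
        rw [← Complex.normSq_eq_norm_sq, Complex.normSq_apply]; simp; ring
      have hxu : (x - u) ^ 2 ≤ η ^ 2 := by
        rw [sq_le_sq, abs_of_pos hη0, abs_le]
        constructor <;> linarith [hu.1, hu.2]
      rw [e, div_le_div_iff₀ (by positivity) (by positivity)]
      linarith
    have h3 : ∫ u in Ioc a b, 2 / ‖(x : ℂ) + η * Complex.I - (u : ℂ)‖ ^ 2 ∂ν ≤
        poissonInt ν (x + η * Complex.I) :=
      setIntegral_le_integral hint (Eventually.of_forall fun u => by positivity)
    rw [setIntegral_const, smul_eq_mul] at h2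
    have h4 : ν.real (Ioc a b) * (1 / η ^ 2) ≤ C := h2.trans (h3.trans h1)
    have h5 : ν.real (Ioc a b) ≤ C * η ^ 2 := by
      rw [mul_one_div, div_le_iff₀ (by positivity)] at h4; exact h4
    have hC0 : 0 ≤ C := (poissonInt_nonneg _ _).trans h1
    refine h5.trans ?_
    have : η ^ 2 ≤ (b - a) ^ 2 := by rw [hη]; nlinarith [sq_nonneg (b - a)]
    gcongr
  have hC0 : 0 ≤ C := (poissonInt_nonneg _ _).trans (hC p ρ (by simpa using hρ.le) hρ le_rfl)
  let G : ℝ → ℝ := fun x => ν.real (Ioc (p - ρ) x)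
  have hG : ∀ x y, p - ρ ≤ x → x ≤ y → y ≤ p + ρ → G y - G x ≤ C * (y - x) ^ 2 ∧ 0 ≤ G y - G x := by
    intro x y hx hxy hy
    rcases hxy.eq_or_lt with rfl | hlt
    · simp
    have e : G y = G x + ν.real (Ioc x y) := by
      simp only [G]
      rw [← measureReal_union (Ioc_disjoint_Ioc_of_le le_rfl) measurableSet_Ioc,
        Ioc_union_Ioc_eq_Ioc hx hxy]
    rw [e]
    constructor
    · linarith [hIoc x y hx hlt hy]
    · simp
  have habs : ∀ x ∈ Icc (p - ρ) (p + ρ), ∀ y ∈ Icc (p - ρ) (p + ρ),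
      ‖G y - G x‖ ≤ C * ‖(y - x) ^ 2‖ := by
    intro x hx y hy
    rw [Real.norm_eq_abs, Real.norm_eq_abs, abs_of_nonneg (sq_nonneg (y - x))]
    rcases le_total x y with h | h
    · have := hG x y hx.1 h hy.2
      rw [abs_of_nonneg this.2]; exact this.1
    · have := hG y x hy.1 h hx.2
      rw [abs_sub_comm, abs_of_nonneg this.2]; linarith [this.1]
  -- Quadratic increments force zero derivative, so the distribution function is constant and the
  -- interval carries no mass.
  have hder : ∀ x ∈ Icc (p - ρ) (p + ρ), HasDerivWithinAt G 0 (Icc (p - ρ) (p + ρ)) x := by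
    intro x hx
    rw [hasDerivWithinAt_iff_isLittleO]
    have ht : Tendsto (fun r : ℝ => r - x) (𝓝[Icc (p - ρ) (p + ρ)] x) (𝓝 0) :=
      ((continuous_id.sub continuous_const).tendsto' x 0 (sub_self x)).mono_left nhdsWithin_le_nhds
    refine Asymptotics.IsBigO.trans_isLittleO ?_
      ((Asymptotics.isLittleO_pow_id (𝕜 := ℝ) (n := 2) one_lt_two).comp_tendsto ht)
    refine Asymptotics.IsBigO.of_bound C ?_
    filter_upwards [self_mem_nhdsWithin] with y hy
    simpa using habs x hx y hy
  have hconst := constant_of_has_deriv_right_zero (f := G) (a := p - ρ) (b := p + ρ)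
    (fun x hx => (hder x hx).continuousWithinAt) (fun x hx =>
      (hder x ⟨hx.1, hx.2.le⟩).mono_of_mem_nhdsWithin (mem_of_superset (Icc_mem_nhdsGE hx.2)
        (Icc_subset_Icc_left hx.1)))
  have hz : ν.real (Ioc (p - ρ) (p + ρ)) = 0 := by
    have := hconst (p + ρ) ⟨by linarith, le_rfl⟩
    simpa [G] using this
  rw [measureReal_eq_zero_iff] at hz
  have : ∀ᵐ u ∂ν, u ∉ Ioc (p - ρ) (p + ρ) := measure_eq_zero_iff_ae_notMem.1 hz
  filter_upwards [this] with u hu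
  rw [← Complex.ofReal_sub, Complex.norm_real, Real.norm_eq_abs]
  by_contra hlt
  rw [not_le, abs_lt] at hlt
  exact hu ⟨by linarith [hlt.2], by linarith [hlt.1]⟩

section

variable {μ₀ : ProbabilityMeasure ℝ} {μ : ℝ → ProbabilityMeasure ℝ} {s κ : ℝ} {ζ : ℂ}

lemma greenFn_charMap_of_im_pos (hμ : IsHydrodynamicLimit μ₀ μ) (hs : 0 ≤ s) {x : ℂ}
    (hx : 0 < x.im) (hF : 0 < (charMap μ₀ s x).im) :
    greenFn (μ s : Measure ℝ) (charMap μ₀ s x) = greenFn μ₀ x := by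
  have := greenFn_characteristic hμ (a := x) (b := greenFn μ₀ x) (T := s) (r₀ := 0)
    ⟨le_rfl, hs⟩ hx hF (by simp [hμ.initial]) s ⟨hs, le_rfl⟩
  exact this

/-- Real characteristics issued far enough from the support of `μ₀` avoid the support of `μ s`. -/
lemma real_characteristic (hμ : IsHydrodynamicLimit μ₀ μ) (hs : 0 ≤ s) (hκ : 0 < κ)
    (hζ : FarFrom μ₀ (2 * √s + 2 * κ) ζ) (hr : ζ.im = 0) :
    FarFrom (μ s) (κ / (2 * √s + κ) * κ / 2) (charMap μ₀ s ζ) ∧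
      greenFn (μ s : Measure ℝ) (charMap μ₀ s ζ) = greenFn μ₀ ζ := by
  have hD : 0 < 2 * √s + κ := by positivity
  set θ := κ / (2 * √s + κ) with hθ
  have hθ0 : 0 < θ := by positivity
  have hFim : (charMap μ₀ s ζ).im = 0 := by
    rw [charMap_im hκ (hζ.mono (by linarith)), hr, zero_mul]
  set p := (charMap μ₀ s ζ).re with hp
  have hpe : charMap μ₀ s ζ = (p : ℂ) := Complex.ext (by simp [hp]) (by simp [hFim])
  -- Every `w` slightly above the real point lies on a characteristic. Its origin `x` has positive
  -- imaginary part because `charMap` multiplies imaginary parts by a factor of at least `θ`, so the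
  -- Green's function at `w` is already known.
  have key : ∀ w : ℂ, 0 < w.im → ‖w - charMap μ₀ s ζ‖ ≤ θ * κ → ∃ x : ℂ,
      FarFrom μ₀ (2 * √s + κ) x ∧ charMap μ₀ s x = w ∧ θ * x.im ≤ w.im ∧
      greenFn (μ s : Measure ℝ) w = greenFn μ₀ x ∧ 0 < x.im := by
    intro w hw hwd
    obtain ⟨x, hx1, hx2⟩ := exists_charMap_eq hs hκ hζ hwd
    have hfx : FarFrom μ₀ (2 * √s + κ) x := (hζ.of_dist hx1).mono (by linarith)
    have him := charMap_im hκ hfx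
    have hpo := le_one_sub_poissonInt hs hκ hfx
    rw [hx2] at him
    have hx0 : 0 < x.im := by
      by_contra hneg
      rw [not_lt] at hneg
      have : x.im * (1 - 2 * s * poissonInt μ₀ x) ≤ 0 :=
        mul_nonpos_of_nonpos_of_nonneg hneg (hθ0.le.trans hpo)
      linarith
    refine ⟨x, hfx, hx2, ?_, ?_, hx0⟩
    · rw [him]; nlinarith
    · rw [← hx2]; exact greenFn_charMap_of_im_pos hμ hs hx0 (by rw [hx2]; exact hw)
  have hρ : 0 < θ * κ / 2 := by positivity
  have hfar : FarFrom (μ s) (θ * κ / 2) (charMap μ₀ s ζ) := by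
    rw [hpe]
    -- Equal Green's functions give $\eta P_s(w)=\operatorname{Im}y\,P_0(y)$ for the Poisson
    -- integrals; then $\operatorname{Im}y\le\eta/\theta$ and the bound on $P_0(y)$ yield the
    -- constant.
    refine farFrom_of_poissonInt_le (C := 2 / (2 * √s + κ) ^ 2 / θ) hρ fun x η hx hη hη2 => ?_
    set w : ℂ := x + η * Complex.I with hw
    have him : w.im = η := by simp [hw]
    obtain ⟨y, hy1, hy2, hy3, hy4, hy0⟩ := key w (by rw [him]; exact hη) (by
      have e : w - charMap μ₀ s ζ = ((x - p : ℝ) : ℂ) + η * Complex.I := by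
        rw [hpe, hw]; push_cast; ring
      rw [e]
      refine (norm_add_le _ _).trans ?_
      rw [Complex.norm_real, norm_mul, Complex.norm_real, Complex.norm_I, Real.norm_eq_abs,
        Real.norm_eq_abs, abs_of_pos hη]
      linarith)
    have hfarw : FarFrom (μ s : Measure ℝ) η w :=
      (farFrom_im _ w).mono (by rw [him]; exact le_abs_self _)
    have e1 := greenFn_im hη hfarw
    rw [hy4, greenFn_im hD hy1, him] at e1
    have e2 : y.im * poissonInt μ₀ y = η * poissonInt (μ s : Measure ℝ) w := by linarith
    have h3 := poissonInt_le hD hy1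
    rw [him] at hy3
    rw [le_div_iff₀ hθ0]
    have h4 : poissonInt (μ s : Measure ℝ) w * η ≤ 2 / (2 * √s + κ) ^ 2 * y.im := by
      rw [mul_comm, ← e2, mul_comm]; gcongr
    have h5 : (poissonInt (μ s : Measure ℝ) w * θ) * y.im ≤ 2 / (2 * √s + κ) ^ 2 * y.im :=
      le_trans (by
        have := mul_le_mul_of_nonneg_left hy3 (poissonInt_nonneg (μ s : Measure ℝ) w)
        linarith) h4
    exact le_of_mul_le_mul_right h5 hy0
  refine ⟨hfar, ?_⟩
  set ρ := θ * κ / 2 with hρd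
  -- Now that the real point is known to be far from `μ s`, the Green's function is Lipschitz there,
  -- and its value is obtained by letting points above descend to it.
  have hbound : ∀ η : ℝ, 0 < η → η ≤ ρ / 2 →
      ‖greenFn (μ s : Measure ℝ) (charMap μ₀ s ζ) - greenFn μ₀ ζ‖ ≤
        (2 / (ρ / 2) ^ 2 + 2 / (2 * √s + κ) ^ 2 / θ) * η := by
    intro η hη hη2
    set w := charMap μ₀ s ζ + η * Complex.I with hw
    have hwn : ‖w - charMap μ₀ s ζ‖ = η := by simp [hw, abs_of_pos hη]
    obtain ⟨y, hy1, hy2, -, hy4, -⟩ := key w (by simp [hw, hFim, hη]) (by rw [hwn]; linarith)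
    have h1 := norm_greenFn_sub_le (ν := (μ s : Measure ℝ)) (d := ρ / 2) (by linarith)
      (a := w) (b := charMap μ₀ s ζ)
      ((hfar.of_dist hwn.le).mono (by linarith)) (hfar.mono (by linarith))
    have hζ' : FarFrom μ₀ (2 * √s + κ) ζ := hζ.mono (by linarith)
    have h2 := norm_greenFn_sub_le hD hy1 hζ'
    have h3 := norm_sub_le_charMap hs hκ hy1 hζ'
    rw [hy2, hwn] at h3
    rw [hwn] at h1
    have h4 : ‖y - ζ‖ ≤ η / θ := by rw [le_div_iff₀ hθ0]; linarith
    have e : greenFn (μ s : Measure ℝ) (charMap μ₀ s ζ) - greenFn μ₀ ζ =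
        (greenFn μ₀ y - greenFn μ₀ ζ) -
          (greenFn (μ s : Measure ℝ) w - greenFn (μ s : Measure ℝ) (charMap μ₀ s ζ)) := by
      rw [hy4]; ring
    rw [e]
    refine (norm_sub_le _ _).trans ?_
    have h5 : 2 / (2 * √s + κ) ^ 2 * ‖y - ζ‖ ≤ 2 / (2 * √s + κ) ^ 2 * (η / θ) := by gcongr
    have e3 : 2 / (2 * √s + κ) ^ 2 * (η / θ) = 2 / (2 * √s + κ) ^ 2 / θ * η := by ring
    linarith
  have hlim : ‖greenFn (μ s : Measure ℝ) (charMap μ₀ s ζ) - greenFn μ₀ ζ‖ ≤ 0 := by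
    set C := 2 / (ρ / 2) ^ 2 + 2 / (2 * √s + κ) ^ 2 / θ with hC
    have ht : Tendsto (fun η : ℝ => C * η) (𝓝[>] 0) (𝓝 0) := by
      have : Tendsto (fun η : ℝ => C * η) (𝓝 0) (𝓝 0) :=
        (continuous_const.mul continuous_id).tendsto' 0 0 (by simp)
      exact this.mono_left nhdsWithin_le_nhds
    refine ge_of_tendsto ht ?_
    filter_upwards [Ioc_mem_nhdsGT (show (0 : ℝ) < ρ / 2 by linarith)] with η hη
    exact hbound η hη.1 hη.2
  exact sub_eq_zero.1 (norm_le_zero_iff.1 hlim)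

end

/-! ### Injectivity of $we^w$ on the principal range -/

section Injectivity

/-- For $w=\rho e^{i\alpha}$ the level curve $\alpha+\rho\sin\alpha=c$ of $\arg(we^w)$ is
$\rho=(c-\alpha)/\sin\alpha$. Along it $\log|we^w|$ has derivative minus a sum of two squares over
$c-\alpha$. -/
lemma strictAntiOn_logPolar {c : ℝ} (hc : c ≤ Real.pi) :
    StrictAntiOn (fun α : ℝ => Real.log ((c - α) / Real.sin α)
      + (c - α) / Real.sin α * Real.cos α) (Ioo 0 c) := by
  have hsin : ∀ α ∈ Ioo 0 c, 0 < Real.sin α := fun α hα =>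
    Real.sin_pos_of_pos_of_lt_pi hα.1 (hα.2.trans_le hc)
  have hder : ∀ α ∈ Ioo 0 c, HasDerivAt (fun α : ℝ => Real.log ((c - α) / Real.sin α)
      + (c - α) / Real.sin α * Real.cos α)
      (-(1 / (c - α)) * ((1 + (c - α) * Real.cos α / Real.sin α) ^ 2 + (c - α) ^ 2)) α := by
    intro α hα
    have hs := hsin α hα
    have hca : 0 < c - α := sub_pos.2 hα.2
    have h1 : HasDerivAt (fun α : ℝ => (c - α) / Real.sin α)
        (((-1) * Real.sin α - (c - α) * Real.cos α) / Real.sin α ^ 2) α :=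
      ((hasDerivAt_id α).const_sub c).div (Real.hasDerivAt_sin α) hs.ne'
    have h2 := (h1.log (div_pos hca hs).ne').add (h1.mul (Real.hasDerivAt_cos α))
    refine h2.congr_deriv ?_
    have hs' := hs.ne'
    have hc' := hca.ne'
    field_simp
    ring
  refine strictAntiOn_of_deriv_neg (convex_Ioo 0 c)
    (fun α hα => (hder α hα).continuousAt.continuousWithinAt) fun α hα => ?_
  rw [interior_Ioo] at hα
  rw [(hder α hα).deriv]
  have hca : 0 < c - α := sub_pos.2 hα.2
  have : 0 < 1 / (c - α) := by positivity
  have : 0 < (1 + (c - α) * Real.cos α / Real.sin α) ^ 2 + (c - α) ^ 2 := by positivity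
  nlinarith

lemma mul_cos_lt_sin {β : ℝ} (h0 : 0 < β) (h1 : β < Real.pi) : β * Real.cos β < Real.sin β := by
  have hs := Real.sin_pos_of_pos_of_lt_pi h0 h1
  rcases lt_or_ge β (Real.pi / 2) with h | h
  · have hc := Real.cos_pos_of_mem_Ioo ⟨by linarith, h⟩
    have := Real.lt_tan h0 h
    rwa [Real.tan_eq_sin_div_cos, lt_div_iff₀ hc] at this
  · have : Real.cos β ≤ 0 := Real.cos_nonpos_of_pi_div_two_le_of_le h (by linarith)
    nlinarith

lemma log_add_strictMono {a b : ℝ} (ha : 0 < a) (hab : a < b) :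
    Real.log a + a < Real.log b + b := add_lt_add (Real.log_lt_log ha hab) hab

lemma log_sub_lt {a b : ℝ} (ha : 0 < a) (hab : a < b) (hb : b ≤ 1) :
    Real.log a - a < Real.log b - b := by
  have hb0 := ha.trans hab
  have h := Real.log_lt_sub_one_of_pos (div_pos ha hb0) (div_lt_one hb0 |>.2 hab).ne
  rw [Real.log_div ha.ne' hb0.ne'] at h
  have : a / b - 1 ≤ a - b := by
    rw [div_sub_one hb0.ne', div_le_iff₀ hb0]
    nlinarith
  linarith

/-- Argument and modulus of $we^w$ determine $w$: for $c=0$ the level curve is the positive axis,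
and for $c>0$ monotonicity along the curve decides. At $c=\pi$ the segment $\alpha=\pi$, $\rho\le1$
competes with the curve, but $\log|we^w|$ is at most $-1$ on the former and above $-1$ on the
latter. -/
lemma polar_injective {ρ ρ' α α' c : ℝ} (hρ : 0 < ρ) (hρ' : 0 < ρ') (hα : α ∈ Ioc (-Real.pi) Real.pi)
    (hα' : α' ∈ Ioc (-Real.pi) Real.pi) (hc0 : 0 ≤ c) (hc : c ≤ Real.pi)
    (h : α + ρ * Real.sin α = c) (h' : α' + ρ' * Real.sin α' = c)
    (hpi : α = Real.pi → ρ ≤ 1) (hpi' : α' = Real.pi → ρ' ≤ 1)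
    (he : Real.log ρ + ρ * Real.cos α = Real.log ρ' + ρ' * Real.cos α') : ρ = ρ' ∧ α = α' := by
  have hnn : ∀ {ρ α : ℝ}, 0 < ρ → α ∈ Ioc (-Real.pi) Real.pi → α + ρ * Real.sin α = c → 0 ≤ α := by
    intro ρ α hρ hα h
    by_contra hneg
    rw [not_le] at hneg
    have := Real.sin_neg_of_neg_of_neg_pi_lt hneg hα.1
    nlinarith
  have hα0 := hnn hρ hα h
  have hα0' := hnn hρ' hα' h'
  have hs : 0 ≤ Real.sin α := Real.sin_nonneg_of_nonneg_of_le_pi hα0 hα.2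
  have hs' : 0 ≤ Real.sin α' := Real.sin_nonneg_of_nonneg_of_le_pi hα0' hα'.2
  rcases hc0.eq_or_lt with hc0 | hc0
  · have e : α = 0 := by nlinarith
    have e' : α' = 0 := by nlinarith
    subst e; subst e'
    simp only [Real.cos_zero, mul_one] at he
    refine ⟨?_, rfl⟩
    rcases lt_trichotomy ρ ρ' with hl | hl | hl
    · exact absurd he (log_add_strictMono hρ hl).ne
    · exact hl
    · exact absurd he (log_add_strictMono hρ' hl).ne'
  have hpos : ∀ {ρ α : ℝ}, 0 < ρ → 0 ≤ α → α + ρ * Real.sin α = c → 0 < α := by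
    intro ρ α hρ h0 h
    rcases h0.eq_or_lt with e | e
    · rw [← e] at h; simp at h; linarith
    · exact e
  have hα1 := hpos hρ hα0 h
  have hα1' := hpos hρ' hα0' h'
  have hmem : ∀ {ρ α : ℝ}, 0 < ρ → 0 < α → α < Real.pi → α + ρ * Real.sin α = c →
      α ∈ Ioo 0 c ∧ ρ = (c - α) / Real.sin α := by
    intro ρ α hρ h0 h1 h
    have hs := Real.sin_pos_of_pos_of_lt_pi h0 h1
    refine ⟨⟨h0, ?_⟩, ?_⟩
    · have := mul_pos hρ hs; linarith
    · rw [eq_div_iff hs.ne']; linarith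
  have hgt : ∀ {ρ α : ℝ}, 0 < ρ → 0 < α → α < Real.pi → α + ρ * Real.sin α = Real.pi →
      -1 < Real.log ρ + ρ * Real.cos α := by
    intro ρ α hρ h0 h1 h
    have hs := Real.sin_pos_of_pos_of_lt_pi h0 h1
    have h2 := mul_cos_lt_sin (β := Real.pi - α) (by linarith) (by linarith)
    rw [Real.cos_pi_sub, Real.sin_pi_sub] at h2
    have h3 : Real.sin α < Real.pi - α := by
      have := Real.sin_lt (x := Real.pi - α) (by linarith)
      rwa [Real.sin_pi_sub] at this
    have h4 : ρ * Real.sin α = Real.pi - α := by linarith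
    have h5 : 1 < ρ := by nlinarith
    have h6 : 0 < Real.log ρ := Real.log_pos h5
    have h7 : -1 < ρ * Real.cos α := by
      rw [← h4] at h2
      have : 0 < Real.sin α * (ρ * Real.cos α + 1) := by linarith
      have := (mul_pos_iff_of_pos_left hs).1 this
      linarith
    linarith
  have hle : ∀ {ρ : ℝ}, 0 < ρ → Real.log ρ - ρ ≤ -1 := fun h => by
    have := Real.log_le_sub_one_of_pos h; linarith
  rcases hα.2.eq_or_lt with e | e <;> rcases hα'.2.eq_or_lt with e' | e'
  · refine ⟨?_, by rw [e, e']⟩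
    have r1 := hpi e
    have r2 := hpi' e'
    rw [e, e', Real.cos_pi] at he
    rcases lt_trichotomy ρ ρ' with hl | hl | hl
    · have := log_sub_lt hρ hl r2; linarith
    · exact hl
    · have := log_sub_lt hρ' hl r1; linarith
  · have hcp : c = Real.pi := by rw [← h, e]; simp
    have := hgt hρ' hα1' e' (h'.trans hcp)
    have h3 := hle hρ
    rw [e, Real.cos_pi] at he
    linarith
  · have hcp : c = Real.pi := by rw [← h', e']; simp
    have := hgt hρ hα1 e (h.trans hcp)
    have h3 := hle hρ'
    rw [e', Real.cos_pi] at he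
    linarith
  · obtain ⟨m, r⟩ := hmem hρ hα1 e h
    obtain ⟨m', r'⟩ := hmem hρ' hα1' e' h'
    have : α = α' := by
      refine (strictAntiOn_logPolar hc).injOn m m' ?_
      rw [← r, ← r']; exact he
    exact ⟨by rw [r, r', this], this⟩

lemma log_norm_add_re {w : ℂ} (hw : w ≠ 0) :
    w * Complex.exp w = Complex.exp (((Real.log ‖w‖ + w.re : ℝ) : ℂ)
      + ((w.im + w.arg : ℝ) : ℂ) * Complex.I) := by
  have h : Complex.exp (Complex.log w) = w := Complex.exp_log hw
  have e : w * Complex.exp w = Complex.exp (Complex.log w + w) := by rw [Complex.exp_add, h]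
  rw [e]
  congr 1
  apply Complex.ext
  · simp [Complex.log_re]
  · simp [Complex.log_im]; ring

/-- `w ↦ w e ^ w` is injective on the range of the principal branch of the Lambert function. -/
lemma lambert_injective {w w' : ℂ} (hw : w ∈ lambertRange) (hw' : w' ∈ lambertRange) (h0 : w ≠ 0)
    (h0' : w' ≠ 0) (h : w * Complex.exp w = w' * Complex.exp w') : w = w' := by
  rw [log_norm_add_re h0, log_norm_add_re h0'] at h
  have hn := congrArg norm h
  rw [Complex.norm_exp, Complex.norm_exp] at hn
  have hre : Real.log ‖w‖ + w.re = Real.log ‖w'‖ + w'.re := by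
    have := Real.exp_injective hn
    simpa using this
  have him : w.im + w.arg = w'.im + w'.arg := by
    have h2 := congrArg Complex.arg h
    rw [Complex.arg_exp, Complex.arg_exp] at h2
    have e : ∀ x : ℂ, (((Real.log ‖x‖ + x.re : ℝ) : ℂ)
      + ((x.im + x.arg : ℝ) : ℂ) * Complex.I).im = x.im + x.arg := fun x => by simp
    rw [e, e] at h2
    rwa [(toIocMod_eq_self _).2 ⟨hw.1.1, by linarith [hw.1.2]⟩,
      (toIocMod_eq_self _).2 ⟨hw'.1.1, by linarith [hw'.1.2]⟩] at h2
  have polar : ∀ x : ℂ, x ≠ 0 → x.re = ‖x‖ * Real.cos x.arg ∧ x.im = ‖x‖ * Real.sin x.arg :=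
    fun x _ => ⟨(Complex.norm_mul_cos_arg x).symm, (Complex.norm_mul_sin_arg x).symm⟩
  have hpi : ∀ x : ℂ, x ∈ lambertRange → x.arg = Real.pi → ‖x‖ ≤ 1 := by
    intro x hx hp
    have h1 := (Complex.arg_eq_pi_iff.1 hp)
    have h2 := hx.2 h1.2
    have h3 := Complex.norm_mul_cos_arg x
    rw [hp, Real.cos_pi] at h3
    linarith
  have fin : ‖w‖ = ‖w'‖ ∧ w.arg = w'.arg → w = w' := fun ⟨e1, e2⟩ =>
    Complex.ext_norm_arg e1 e2
  obtain ⟨p1, p2⟩ := polar w h0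
  obtain ⟨p1', p2'⟩ := polar w' h0'
  apply fin
  rcases le_or_gt 0 (w.im + w.arg) with hc | hc
  · exact polar_injective (norm_pos_iff.2 h0) (norm_pos_iff.2 h0') (Complex.arg_mem_Ioc w)
      (Complex.arg_mem_Ioc w') hc hw.1.2 (by rw [← p2]; ring) (by rw [← p2', him]; ring)
      (hpi w hw) (hpi w' hw') (by rw [← p1, ← p1']; exact hre)
  -- The lower half follows by conjugation; negating the argument is legitimate because argument `π`
  -- cannot occur here.
  · have hne : ∀ x : ℂ, x.im + x.arg < 0 → x.arg ≠ Real.pi := by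
      intro x hx hp
      have := (Complex.arg_eq_pi_iff.1 hp).2
      rw [this, hp] at hx
      linarith [Real.pi_pos]
    have n1 := hne w hc
    have n2 := hne w' (him ▸ hc)
    have i1 : -w.arg ∈ Ioc (-Real.pi) Real.pi :=
      ⟨by have := lt_of_le_of_ne (Complex.arg_le_pi w) n1; linarith,
        by linarith [Complex.neg_pi_lt_arg w]⟩
    have i2 : -w'.arg ∈ Ioc (-Real.pi) Real.pi :=
      ⟨by have := lt_of_le_of_ne (Complex.arg_le_pi w') n2; linarith,
        by linarith [Complex.neg_pi_lt_arg w']⟩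
    have key := polar_injective (c := -(w.im + w.arg)) (norm_pos_iff.2 h0) (norm_pos_iff.2 h0') i1 i2
      (by linarith) (by linarith [hw.1.1]) (by rw [Real.sin_neg]; linarith)
      (by rw [Real.sin_neg]; linarith)
      (fun e => by linarith [Complex.neg_pi_lt_arg w])
      (fun e => by linarith [Complex.neg_pi_lt_arg w'])
      (by rw [Real.cos_neg, Real.cos_neg, ← p1, ← p1']; exact hre)
    exact ⟨key.1, neg_injective key.2⟩

/-- From $\sin\alpha\le\pi-\alpha$ and its mirror image. It allows the whole proof to work with
solutions in the unit disc, where moreover $(we^w)'\ne0$. -/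
lemma mem_lambertRange_of_norm_lt_one {w : ℂ} (hw : ‖w‖ < 1) : w ∈ lambertRange := by
  have hs : w.im = ‖w‖ * Real.sin w.arg := (Complex.norm_mul_sin_arg w).symm
  refine ⟨?_, fun _ => ?_⟩
  · rcases le_or_gt 0 w.arg with h | h
    · have h1 := Real.sin_nonneg_of_nonneg_of_le_pi h (Complex.arg_le_pi w)
      have h2 : Real.sin w.arg ≤ Real.pi - w.arg := by
        rw [← Real.sin_pi_sub]; exact Real.sin_le (by linarith [Complex.arg_le_pi w])
      have h3 : 0 ≤ ‖w‖ * Real.sin w.arg := by positivity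
      have h4 : ‖w‖ * Real.sin w.arg ≤ 1 * Real.sin w.arg := by gcongr
      exact ⟨by linarith [Real.pi_pos], by linarith⟩
    · have h0 := Complex.neg_pi_lt_arg w
      have h1 := Real.sin_neg_of_neg_of_neg_pi_lt h h0
      have h2 : -Real.sin w.arg ≤ w.arg + Real.pi := by
        rw [← Real.sin_add_pi]; exact Real.sin_le (by linarith)
      have h3 : ‖w‖ * Real.sin w.arg ≤ 0 := mul_nonpos_of_nonneg_of_nonpos (norm_nonneg _) h1.le
      have h4 : Real.sin w.arg < ‖w‖ * Real.sin w.arg := by nlinarith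
      exact ⟨by linarith, by linarith [Real.pi_pos]⟩
  · have := Complex.abs_re_le_norm w
    rw [abs_le] at this
    linarith [this.1]

end Injectivity

/-! ### The map $y\mapsto ye^{2/y^2}$ and the shape $\mathcal K$ -/

section Hull

/-- The inverse of the hydrodynamic limit map at time one, in characteristic coordinates. -/
def outerMap (y : ℂ) : ℂ := y * Complex.exp (2 / y ^ 2)

/-- Polar coordinates adapted to the symmetry axis of `universalHull`. -/
lemma exists_polar {y : ℂ} (hy : 0 ≤ y.im) :
    ∃ φ ∈ Icc (-(Real.pi / 2)) (Real.pi / 2),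
      y = Complex.I * ‖y‖ * Complex.exp (-(Complex.I * φ)) := by
  refine ⟨Real.pi / 2 - y.arg, ⟨by linarith [Complex.arg_le_pi y],
    by linarith [Complex.arg_nonneg_iff.2 hy]⟩, ?_⟩
  have h := Complex.norm_mul_exp_arg_mul_I y
  have e : -(Complex.I * ((Real.pi / 2 - y.arg : ℝ) : ℂ))
      = -(Real.pi / 2 * Complex.I) + y.arg * Complex.I := by push_cast; ring
  have e2 : Complex.exp (-(Real.pi / 2 * Complex.I)) = -Complex.I := by
    rw [Complex.exp_neg, Complex.exp_pi_div_two_mul_I, Complex.inv_I]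
  rw [e, Complex.exp_add, e2]
  linear_combination -h + ‖y‖ * Complex.exp (y.arg * Complex.I) * Complex.I_sq

lemma exp_polar (k φ : ℝ) :
    Complex.exp (-(Complex.I * φ) - k * Complex.exp (2 * Complex.I * φ))
      = (Real.exp (-(k * Real.cos (2 * φ))) : ℝ)
        * Complex.exp (((-(φ + k * Real.sin (2 * φ)) : ℝ) : ℂ) * Complex.I) := by
  have e : Complex.exp (2 * Complex.I * φ) = Real.cos (2 * φ) + Real.sin (2 * φ) * Complex.I := by
    rw [show 2 * Complex.I * (φ : ℂ) = ((2 * φ : ℝ) : ℂ) * Complex.I by push_cast; ring,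
      Complex.exp_mul_I, Complex.ofReal_cos, Complex.ofReal_sin]
  rw [e, Complex.ofReal_exp, ← Complex.exp_add]
  congr 1
  push_cast; ring

/-- The circle of radius $\rho$ is parametrised in the same form as $\mathcal K$, with $k=2/\rho^2$
in place of $1/2$; at $\rho=2$ the two agree with $r=1$. -/
lemma outerMap_polar {ρ φ : ℝ} (hρ : 0 < ρ) :
    outerMap (Complex.I * ρ * Complex.exp (-(Complex.I * φ))) =
      Complex.I * ρ * Complex.exp (-(Complex.I * φ)
        - ((2 / ρ ^ 2 : ℝ) : ℂ) * Complex.exp (2 * Complex.I * φ)) := by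
  have hρ' : (ρ : ℂ) ≠ 0 := by exact_mod_cast hρ.ne'
  have e : 2 / (Complex.I * ρ * Complex.exp (-(Complex.I * φ))) ^ 2 =
      -(((2 / ρ ^ 2 : ℝ) : ℂ) * Complex.exp (2 * Complex.I * φ)) := by
    rw [mul_pow, mul_pow, Complex.I_sq, ← Complex.exp_nat_mul,
      show ((2 : ℕ) : ℂ) * -(Complex.I * φ) = -(2 * Complex.I * φ) by push_cast; ring,
      Complex.exp_neg]
    have := Complex.exp_ne_zero (2 * Complex.I * φ)
    push_cast
    field_simp
  rw [outerMap, e, mul_assoc, ← Complex.exp_add]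
  congr 2

lemma im_polar (k φ ρ : ℝ) :
    (Complex.I * ρ * Complex.exp (-(Complex.I * φ)
        - (k : ℂ) * Complex.exp (2 * Complex.I * φ))).im =
      ρ * Real.exp (-(k * Real.cos (2 * φ))) * Real.cos (φ + k * Real.sin (2 * φ)) := by
  rw [exp_polar]
  have h := Complex.exp_ofReal_mul_I_re (-(φ + k * Real.sin (2 * φ)))
  rw [Real.cos_neg] at h
  generalize Complex.exp (((-(φ + k * Real.sin (2 * φ)) : ℝ) : ℂ) * Complex.I) = c at h ⊢
  generalize Real.exp (-(k * Real.cos (2 * φ))) = E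
  rw [← h]
  simp; ring

lemma abs_angle_le {k φ : ℝ} (hk : 0 ≤ k) (hk2 : k ≤ 1 / 2)
    (hφ : φ ∈ Icc (-(Real.pi / 2)) (Real.pi / 2)) :
    φ + k * Real.sin (2 * φ) ∈ Icc (-(Real.pi / 2)) (Real.pi / 2) := by
  have h1 : Real.sin (2 * φ) ≤ Real.pi - 2 * φ := by
    rw [← Real.sin_pi_sub]; exact Real.sin_le (by linarith [hφ.2])
  have h2 : -Real.sin (2 * φ) ≤ 2 * φ + Real.pi := by
    rw [← Real.sin_add_pi]; exact Real.sin_le (by linarith [hφ.1])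
  have h3 : 0 ≤ Real.pi - 2 * φ := by linarith [hφ.2]
  have h4 : 0 ≤ 2 * φ + Real.pi := by linarith [hφ.1]
  constructor <;> nlinarith

lemma abs_angle_lt {k φ : ℝ} (hk : 0 ≤ k) (hk2 : k ≤ 1 / 2)
    (hφ : φ ∈ Ioo (-(Real.pi / 2)) (Real.pi / 2)) :
    φ + k * Real.sin (2 * φ) ∈ Ioo (-(Real.pi / 2)) (Real.pi / 2) := by
  have h1 : Real.sin (2 * φ) < Real.pi - 2 * φ := by
    rw [← Real.sin_pi_sub]; exact Real.sin_lt (by linarith [hφ.2])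
  have h2 : -Real.sin (2 * φ) < 2 * φ + Real.pi := by
    rw [← Real.sin_add_pi]; exact Real.sin_lt (by linarith [hφ.1])
  have h3 : 0 < Real.pi - 2 * φ := by linarith [hφ.2]
  have h4 : 0 < 2 * φ + Real.pi := by linarith [hφ.1]
  rcases hk.eq_or_lt with rfl | hk
  · simpa using hφ
  constructor <;> nlinarith

lemma universalHull_polar {z : ℂ} : z ∈ universalHull ↔ ∃ r φ : ℝ, r ∈ Icc (0 : ℝ) 1 ∧
    φ ∈ Icc (-(Real.pi / 2)) (Real.pi / 2) ∧ z = Complex.I * ((2 * r : ℝ) : ℂ) *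
      Complex.exp (-(Complex.I * φ) - ((1 / 2 : ℝ) : ℂ) * Complex.exp (2 * Complex.I * φ)) := by
  have e : ∀ r φ : ℝ, 2 * Complex.I * r *
      Complex.exp (-(Complex.I * φ) - Complex.exp (2 * Complex.I * φ) / 2) =
      Complex.I * ((2 * r : ℝ) : ℂ) *
      Complex.exp (-(Complex.I * φ) - ((1 / 2 : ℝ) : ℂ) * Complex.exp (2 * Complex.I * φ)) := by
    intro r φ
    push_cast
    rw [show Complex.exp (2 * Complex.I * φ) / 2 = 1 / 2 * Complex.exp (2 * Complex.I * φ) by ring]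
    ring
  simp only [universalHull, mem_ofPred_eq, e]

lemma universalHull_im_nonneg {z : ℂ} (hz : z ∈ universalHull) : 0 ≤ z.im := by
  obtain ⟨r, φ, hr, hφ, rfl⟩ := universalHull_polar.1 hz
  rw [im_polar]
  have := Real.cos_nonneg_of_mem_Icc (abs_angle_le (k := 1 / 2) (by norm_num) le_rfl hφ)
  have := hr.1
  positivity

/-- Reflection in the imaginary axis is $\varphi\mapsto-\varphi$, and on real points it is negation.
This settles the sign when only $z^2$ is known. -/
lemma neg_mem_universalHull {z : ℂ} (hz : z ∈ universalHull) (h : z.im = 0) :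
    -z ∈ universalHull := by
  obtain ⟨r, φ, hr, hφ, e⟩ := universalHull_polar.1 hz
  refine universalHull_polar.2 ⟨r, -φ, hr, ⟨by linarith [hφ.2], by linarith [hφ.1]⟩, ?_⟩
  have e1 : -z = -(starRingEnd ℂ) z := by rw [Complex.conj_eq_iff_im.2 h]
  rw [e1, e, map_mul, map_mul, ← Complex.exp_conj, map_sub, map_mul (starRingEnd ℂ)
    ((1 / 2 : ℝ) : ℂ), ← Complex.exp_conj]
  simp only [map_neg, map_mul, Complex.conj_I, Complex.conj_ofReal, Complex.ofReal_neg, map_ofNat]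
  ring_nf

lemma zero_mem_universalHull : (0 : ℂ) ∈ universalHull :=
  ⟨0, 0, by simp, ⟨by linarith [Real.pi_pos], by linarith [Real.pi_pos]⟩, by simp⟩

/-- A boundary value of `w e ^ w` on the unit circle gives a point of `universalHull`. -/
lemma mem_universalHull_of_norm_eq_one {z w : ℂ} {s : ℝ} (hz : 0 ≤ z.im) (hs : s ∈ Icc (0 : ℝ) 1)
    (hz0 : z ≠ 0) (hw : ‖w‖ = 1) (h : w * Complex.exp w = s * (-4 / z ^ 2)) :
    z ∈ universalHull := by
  set φ : ℝ := w.arg / 2 with hφ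
  have hw' : Complex.exp (2 * Complex.I * φ) = w := by
    have := Complex.norm_mul_exp_arg_mul_I w
    rw [hw, Complex.ofReal_one, one_mul] at this
    conv_rhs => rw [← this]
    rw [hφ]; congr 1; push_cast; ring
  -- With $e^{2i\varphi}=w$ and $r=\sqrt s$ the parametrised point satisfies $k^2we^w=-4s=z^2we^w$,
  -- so $z=\pm k$.
  set k : ℂ := 2 * Complex.I * (√s : ℝ) *
      Complex.exp (-(Complex.I * φ) - Complex.exp (2 * Complex.I * φ) / 2) with hk
  have hkm : k ∈ universalHull := ⟨√s, φ, ⟨Real.sqrt_nonneg _, Real.sqrt_le_one.2 hs.2⟩,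
    ⟨by linarith [Complex.neg_pi_lt_arg w], by linarith [Complex.arg_le_pi w]⟩, rfl⟩
  have hsq : ((√s : ℝ) : ℂ) ^ 2 = s := by
    rw [← Complex.ofReal_pow, Real.sq_sqrt hs.1]
  have hk2 : k ^ 2 * (w * Complex.exp w) = -4 * s := by
    have e : Complex.exp (-(Complex.I * φ) - w / 2) ^ 2 * (w * Complex.exp w) = 1 := by
      conv_lhs => rw [← Complex.exp_nat_mul]
      nth_rw 2 [← hw']
      rw [← Complex.exp_add, ← Complex.exp_add, Complex.exp_eq_one_iff]
      exact ⟨0, by push_cast; ring⟩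
    rw [hk, hw', mul_pow, mul_pow, mul_pow, Complex.I_sq, hsq]
    linear_combination (-4 * (s : ℂ)) * e
  have hwne : w * Complex.exp w ≠ 0 := by
    refine mul_ne_zero ?_ (Complex.exp_ne_zero _)
    intro h0; rw [h0, norm_zero] at hw; exact zero_ne_one hw
  have hzk : z ^ 2 = k ^ 2 := by
    have h2 : z ^ 2 * (w * Complex.exp w) = -4 * s := by
      rw [h]; field_simp
    exact mul_right_cancel₀ hwne (h2.trans hk2.symm)
  rcases sq_eq_sq_iff_eq_or_eq_neg.1 hzk with e | e
  · rw [e]; exact hkm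
  · rw [e]
    refine neg_mem_universalHull hkm (le_antisymm ?_ (universalHull_im_nonneg hkm))
    rw [e, Complex.neg_im] at hz; linarith

lemma hasStrictDerivAt_mul_exp (w : ℂ) :
    HasStrictDerivAt (fun w : ℂ => w * Complex.exp w) ((1 + w) * Complex.exp w) w := by
  have := (hasStrictDerivAt_id w).mul (Complex.hasStrictDerivAt_exp w)
  refine this.congr_deriv ?_
  simp; ring

lemma mul_exp_deriv_ne_zero {w : ℂ} (hw : ‖w‖ < 1) : (1 + w) * Complex.exp w ≠ 0 := by
  refine mul_ne_zero ?_ (Complex.exp_ne_zero _)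
  intro h
  have : w = -1 := by linear_combination h
  rw [this] at hw; simp at hw

/-- Continuity method in `s`. The solvable set contains $0$, is open by the inverse function theorem
since $1+w\ne0$, and is closed because a limiting solution on the unit circle would place `z` in
$\mathcal K$. -/
lemma exists_lambert {z : ℂ} (hz : 0 ≤ z.im) (hzK : z ∉ universalHull) {s : ℝ}
    (hs : s ∈ Icc (0 : ℝ) 1) :
    ∃ w : ℂ, ‖w‖ < 1 ∧ w * Complex.exp w = s * (-4 / z ^ 2) := by
  have hz0 : z ≠ 0 := fun h => hzK (h ▸ zero_mem_universalHull)
  set ξ := -4 / z ^ 2 with hξ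
  let S : Set ℝ := {s | ∃ w : ℂ, ‖w‖ < 1 ∧ w * Complex.exp w = s * ξ}
  have hpc : Continuous fun w : ℂ => w * Complex.exp w := by fun_prop
  have hclosed : IsClosed (S ∩ Icc 0 1) := by
    let T : Set (ℝ × ℂ) := (Icc (0 : ℝ) 1 ×ˢ Metric.closedBall (0 : ℂ) 1) ∩
      {x | x.2 * Complex.exp x.2 = x.1 * ξ}
    have hT : IsCompact T := (isCompact_Icc.prod (isCompact_closedBall _ _)).inter_right
      (isClosed_eq (by fun_prop) (by fun_prop))
    have e : S ∩ Icc 0 1 = Prod.fst '' T := by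
      ext x
      constructor
      · rintro ⟨⟨w, hw, hwx⟩, hx⟩
        exact ⟨(x, w), ⟨⟨hx, by simpa using hw.le⟩, hwx⟩, rfl⟩
      · rintro ⟨⟨x, w⟩, ⟨⟨hx, hw⟩, hwx⟩, rfl⟩
        refine ⟨⟨w, lt_of_le_of_ne (by simpa using hw) fun h1 => hzK ?_, hwx⟩, hx⟩
        exact mem_universalHull_of_norm_eq_one hz hx hz0 h1 hwx
    rw [e]
    exact (hT.image continuous_fst).isClosed
  refine hclosed.Icc_subset_of_forall_mem_nhdsWithin ⟨0, by simp, by simp⟩ ?_ hs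
  rintro x ⟨⟨w, hw, hwx⟩, -⟩
  refine nhdsWithin_le_nhds ?_
  have h1 := (hasStrictDerivAt_mul_exp w).map_nhds_eq (mul_exp_deriv_ne_zero hw)
  have h2 : (fun w : ℂ => w * Complex.exp w) '' Metric.ball 0 1 ∈ 𝓝 (w * Complex.exp w) := by
    rw [← h1]
    exact image_mem_map (Metric.isOpen_ball.mem_nhds (by simpa using hw))
  rw [hwx] at h2
  have h3 : Continuous fun x : ℝ => (x : ℂ) * ξ := by fun_prop
  filter_upwards [h3.continuousAt.preimage_mem_nhds h2] with y hy
  obtain ⟨w', hw', e⟩ := hy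
  exact ⟨w', by simpa using hw', e⟩

lemma lambert_injective_ball {w w' : ℂ} (hw : ‖w‖ < 1) (hw' : ‖w'‖ < 1)
    (h : w * Complex.exp w = w' * Complex.exp w') : w = w' := by
  have iff0 : ∀ x : ℂ, x * Complex.exp x = 0 ↔ x = 0 := fun x => by
    simp [Complex.exp_ne_zero]
  by_cases h0 : w = 0
  · rw [(iff0 w).2 h0] at h
    rw [h0, (iff0 w').1 h.symm]
  · have h0' : w' ≠ 0 := fun e => h0 ((iff0 w).1 (h.trans ((iff0 w').2 e)))
    exact lambert_injective (mem_lambertRange_of_norm_lt_one hw)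
      (mem_lambertRange_of_norm_lt_one hw') h0 h0' h

/-- Since $x+\frac12\sin2x$ is increasing and $k\le\frac12$, equality of the two angles forces
$|\varphi'|\le|\varphi|$. -/
lemma cos_two_mul_le_of_angle_eq {k φ φ' : ℝ} (hk : 0 ≤ k) (hk2 : k ≤ 1 / 2)
    (hφ : φ ∈ Icc (-(Real.pi / 2)) (Real.pi / 2))
    (h : φ + k * Real.sin (2 * φ) = φ' + 1 / 2 * Real.sin (2 * φ')) :
    Real.cos (2 * φ) ≤ Real.cos (2 * φ') := by
  have mono : ∀ x y : ℝ, x < y → x + 1 / 2 * Real.sin (2 * x) < y + 1 / 2 * Real.sin (2 * y) := by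
    intro x y hxy
    have h1 := Real.sin_sub_sin (2 * y) (2 * x)
    have h2 : Real.sin ((2 * y - 2 * x) / 2) < y - x := by
      rw [show (2 * y - 2 * x) / 2 = y - x by ring]; exact Real.sin_lt (by linarith)
    have h3 : -(y - x) < Real.sin ((2 * y - 2 * x) / 2) := by
      rw [show (2 * y - 2 * x) / 2 = y - x by ring]
      rcases le_or_gt (y - x) Real.pi with hd | hd
      · linarith [Real.sin_nonneg_of_nonneg_of_le_pi (x := y - x) (by linarith) hd]
      · linarith [Real.neg_one_le_sin (y - x), Real.pi_gt_three]
    have h4 := Real.abs_cos_le_one ((2 * y + 2 * x) / 2)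
    have h5 : |Real.sin ((2 * y - 2 * x) / 2) * Real.cos ((2 * y + 2 * x) / 2)| < y - x := by
      rw [abs_mul]
      have := abs_lt.2 ⟨h3, h2⟩
      have := mul_le_of_le_one_right (abs_nonneg (Real.sin ((2 * y - 2 * x) / 2))) h4
      linarith
    have := (abs_lt.1 h5).1
    linarith
  have core : ∀ φ φ' : ℝ, 0 ≤ φ → φ ≤ Real.pi / 2 →
      φ + k * Real.sin (2 * φ) = φ' + 1 / 2 * Real.sin (2 * φ') →
      Real.cos (2 * φ) ≤ Real.cos (2 * φ') := by
    intro φ φ' h0 h1 h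
    have hs : 0 ≤ Real.sin (2 * φ) :=
      Real.sin_nonneg_of_nonneg_of_le_pi (by linarith) (by linarith)
    have a1 : φ' ≤ φ := by
      by_contra hlt
      rw [not_le] at hlt
      have := mono φ φ' hlt
      nlinarith
    have a2 : 0 ≤ φ' := by
      by_contra hlt
      rw [not_le] at hlt
      have := mono φ' 0 hlt
      simp only [mul_zero, Real.sin_zero, add_zero] at this
      nlinarith
    exact Real.cos_le_cos_of_nonneg_of_le_pi (by linarith) (by linarith) (by linarith)
  rcases le_total 0 φ with h0 | h0
  · exact core φ φ' h0 hφ.2 h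
  · have := core (-φ) (-φ') (by linarith) (by linarith [hφ.1]) (by
      rw [mul_neg, mul_neg, Real.sin_neg, Real.sin_neg]; linarith)
    simpa [mul_neg, Real.cos_neg] using this

/-- Equality of arguments gives $\cos2\varphi\le\cos2\varphi'$. Equality of moduli then gives
$\log(\rho/2)\le(k-\frac12)\cos2\varphi\le\frac12-k$, contrary to `hl3`. -/
lemma outerMap_notMem_universalHull {y : ℂ} (hy : 0 ≤ y.im) (hn : 2 < ‖y‖) :
    outerMap y ∉ universalHull := by
  intro hmem
  obtain ⟨φ, hφ, e⟩ := exists_polar hy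
  set ρ := ‖y‖ with hρ
  have hρ0 : 0 < ρ := by linarith
  obtain ⟨r, φ', hr, hφ', e'⟩ := universalHull_polar.1 hmem
  rw [e, outerMap_polar hρ0] at e'
  set k : ℝ := 2 / ρ ^ 2 with hk
  have hk0 : 0 < k := by positivity
  have hk2 : k < 1 / 2 := by
    rw [hk, div_lt_div_iff₀ (by positivity) (by norm_num)]; nlinarith
  rw [mul_assoc Complex.I, mul_assoc Complex.I] at e'
  have e1 := mul_left_cancel₀ Complex.I_ne_zero e'
  rw [exp_polar, exp_polar, ← mul_assoc, ← mul_assoc, ← Complex.ofReal_mul, ← Complex.ofReal_mul]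
    at e1
  have hn1 := congrArg norm e1
  rw [norm_mul, norm_mul, Complex.norm_exp_ofReal_mul_I, Complex.norm_exp_ofReal_mul_I, mul_one,
    mul_one, Complex.norm_real, Complex.norm_real, Real.norm_eq_abs, Real.norm_eq_abs,
    abs_of_pos (by positivity), abs_of_nonneg (by have := hr.1; positivity)] at hn1
  have hr0 : 0 < r := by
    rcases hr.1.eq_or_lt with h | h
    · rw [← h] at hn1
      have : 0 < ρ * Real.exp (-(k * Real.cos (2 * φ))) := by positivity
      rw [hn1] at this; simp at this
    · exact h
  rw [hn1] at e1
  have hne : ((2 * r * Real.exp (-(1 / 2 * Real.cos (2 * φ'))) : ℝ) : ℂ) ≠ 0 := by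
    have : 0 < 2 * r * Real.exp (-(1 / 2 * Real.cos (2 * φ'))) := by positivity
    exact_mod_cast this.ne'
  have e2 := congrArg Complex.im (mul_left_cancel₀ hne e1)
  rw [Complex.exp_ofReal_mul_I_im, Complex.exp_ofReal_mul_I_im, Real.sin_neg, Real.sin_neg,
    neg_inj] at e2
  have e3 := Real.injOn_sin (abs_angle_le hk0.le hk2.le hφ)
    (abs_angle_le (by norm_num) le_rfl hφ') e2
  have hcos := cos_two_mul_le_of_angle_eq hk0.le hk2.le hφ e3
  have hl := congrArg Real.log hn1
  rw [Real.log_mul hρ0.ne' (Real.exp_ne_zero _), Real.log_mul (by positivity) (Real.exp_ne_zero _),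
    Real.log_exp, Real.log_exp] at hl
  have hl2 : Real.log (2 * r) ≤ Real.log 2 := Real.log_le_log (by positivity) (by linarith [hr.2])
  -- This is $\log x<x-1$ at $x=2k=(2/\rho)^2$.
  have hl3 : 1 / 2 - k < Real.log ρ - Real.log 2 := by
    have h1 := Real.log_lt_sub_one_of_pos (x := 2 * k) (by positivity) (by linarith)
    have h2 : Real.log (2 * k) = 2 * (Real.log 2 - Real.log ρ) := by
      rw [hk, show 2 * (2 / ρ ^ 2) = (2 / ρ) ^ 2 by ring, Real.log_pow, Real.log_div (by norm_num)
        hρ0.ne']; norm_num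
    linarith
  have h4 := Real.neg_one_le_cos (2 * φ)
  nlinarith

lemma outerMap_im_pos {y : ℂ} (hy : 0 < y.im) (hn : 2 ≤ ‖y‖) : 0 < (outerMap y).im := by
  obtain ⟨φ, hφ, e⟩ := exists_polar hy.le
  have hρ0 : 0 < ‖y‖ := by linarith
  have hy' : y.im = ‖y‖ * Real.cos φ := by
    have := congrArg Complex.im e
    rw [this]
    have e2 : -(Complex.I * (φ : ℂ)) = ((-φ : ℝ) : ℂ) * Complex.I := by push_cast; ring
    have h := Complex.exp_ofReal_mul_I_re (-φ)
    rw [Real.cos_neg] at h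
    rw [e2, ← h]
    generalize Complex.exp (((-φ : ℝ) : ℂ) * Complex.I) = c
    generalize ‖y‖ = ρ
    simp
  have hcos : 0 < Real.cos φ := by
    rw [hy'] at hy; exact (mul_pos_iff_of_pos_left hρ0).1 hy
  have hφ' : φ ∈ Ioo (-(Real.pi / 2)) (Real.pi / 2) := by
    refine ⟨lt_of_le_of_ne hφ.1 fun h => ?_, lt_of_le_of_ne hφ.2 fun h => ?_⟩
    · rw [← h, Real.cos_neg, Real.cos_pi_div_two] at hcos; exact lt_irrefl _ hcos
    · rw [h, Real.cos_pi_div_two] at hcos; exact lt_irrefl _ hcos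
  rw [e, outerMap_polar hρ0, im_polar]
  have hk2 : 2 / ‖y‖ ^ 2 ≤ 1 / 2 := by
    rw [div_le_div_iff₀ (by positivity) (by norm_num)]; nlinarith
  have := Real.cos_pos_of_mem_Ioo (abs_angle_lt (k := 2 / ‖y‖ ^ 2) (by positivity) hk2 hφ')
  positivity

/-- Pushing `y` radially outward makes its modulus exceed $2$ while the image stays in the open
interior, so the boundary case reduces to the strict one. -/
lemma outerMap_notMem_interior {y : ℂ} (hy : 0 ≤ y.im) (hn : 2 ≤ ‖y‖) :
    outerMap y ∉ interior universalHull := by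
  intro hmem
  have hy0 : y ≠ 0 := by rw [← norm_pos_iff]; linarith
  have hc : ContinuousAt (fun r : ℝ => outerMap (r * y)) 1 := by
    unfold outerMap
    refine ContinuousAt.mul (by fun_prop) (ContinuousAt.cexp (ContinuousAt.div₀ (by fun_prop)
      (by fun_prop) ?_))
    simpa using hy0
  have h1 : ∀ᶠ r : ℝ in 𝓝[>] 1, outerMap (r * y) ∈ interior universalHull := by
    refine nhdsWithin_le_nhds (hc.preimage_mem_nhds (isOpen_interior.mem_nhds ?_))
    simpa using hmem
  obtain ⟨r, hr, hr1⟩ := (h1.and self_mem_nhdsWithin).exists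
  have hr1 : 1 < r := hr1
  refine outerMap_notMem_universalHull (y := r * y) ?_ ?_ (interior_subset hr)
  · simp only [Complex.im_ofReal_mul]
    exact mul_nonneg (by linarith) hy
  · rw [norm_mul, Complex.norm_real, Real.norm_eq_abs, abs_of_pos (by linarith)]
    nlinarith

lemma lambertW0_eq {z w : ℂ} (hw : ‖w‖ < 1) (hz : z ≠ 0) (h : w * Complex.exp w = z) :
    lambertW0 z = w := by
  have hex : ∃ w ∈ lambertRange, w * Complex.exp w = z :=
    ⟨w, mem_lambertRange_of_norm_lt_one hw, h⟩
  rw [lambertW0, dif_pos hex]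
  have hs := hex.choose_spec
  refine lambert_injective hs.1 (mem_lambertRange_of_norm_lt_one hw) ?_ ?_ (hs.2.trans h.symm)
  · intro h0; rw [h0, zero_mul] at hs; exact hz hs.2.symm
  · intro h0; rw [h0, zero_mul] at h; exact hz h.symm

/-- With $Y=ze^{w/2}$ one has $w=(2i/Y)^2$, so only the sign of the root is in question. It is
settled by showing that $Y$ lies in the closed upper half-plane, and in the open one when `z` does.
-/
lemma sqrtLambert_eq {z w : ℂ} (hz : 0 ≤ z.im) (hz0 : z ≠ 0) (hw : ‖w‖ < 1)
    (h : w * Complex.exp w = -4 / z ^ 2) :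
    sqrtLambert z = 2 * Complex.I / (z * Complex.exp (w / 2)) := by
  set Y := z * Complex.exp (w / 2) with hY
  have hξ : -4 / z ^ 2 ≠ 0 := div_ne_zero (by norm_num) (pow_ne_zero 2 hz0)
  have hw0 : w ≠ 0 := by rintro rfl; rw [zero_mul] at h; exact hξ h.symm
  have hY0 : Y ≠ 0 := mul_ne_zero hz0 (Complex.exp_ne_zero _)
  have hW := lambertW0_eq hw hξ h
  have hY2 : Y ^ 2 = z ^ 2 * Complex.exp w := by
    rw [hY, mul_pow, ← Complex.exp_nat_mul]; congr 2; push_cast; ring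
  have hwY : w = -4 / Y ^ 2 := by
    rw [hY2, eq_div_iff (mul_ne_zero (pow_ne_zero 2 hz0) (Complex.exp_ne_zero _))]
    rw [eq_div_iff (pow_ne_zero 2 hz0)] at h
    linear_combination h
  have hYn : 2 < ‖Y‖ := by
    rw [hwY, norm_div, norm_pow, norm_neg] at hw
    simp only [Complex.norm_ofNat] at hw
    rw [div_lt_one (by positivity)] at hw
    nlinarith [norm_nonneg Y]
  have hfY : outerMap Y = z := by
    have : 2 / Y ^ 2 = -(w / 2) := by rw [hwY]; ring
    rw [outerMap, this, hY, mul_assoc, ← Complex.exp_add]; simp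
  have hneg : outerMap (-Y) = -z := by
    rw [← hfY, outerMap, outerMap]; simp
  have hxsq : (2 * Complex.I / Y) ^ 2 = w := by
    rw [hwY, div_pow, mul_pow, Complex.I_sq]; norm_num
  -- `outerMap` is odd and preserves the upper half-plane beyond radius $2$, so
  -- $\operatorname{Im}Y<0$ would give $\operatorname{Im}z<0$.
  have hYim : 0 ≤ Y.im := by
    by_contra hlt
    rw [not_le] at hlt
    have := outerMap_im_pos (y := -Y) (by simpa using hlt) (by simpa using hYn.le)
    rw [hneg, Complex.neg_im] at this; linarith
  have half : (1 / 2 : ℂ) = 2⁻¹ := by norm_num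
  rcases hz.eq_or_lt with hz1 | hz1
  · have hYr : Y.im = 0 := by
      refine le_antisymm ?_ hYim
      by_contra hlt
      rw [not_le] at hlt
      have := outerMap_im_pos hlt hYn.le
      rw [hfY] at this; linarith
    set t := Y.re with ht
    have hYt : Y = (t : ℂ) := Complex.ext (by simp [ht]) (by simp [hYr])
    have ht0 : t ≠ 0 := fun h => hY0 (by rw [hYt, h]; simp)
    have hzt : z.re = t * Real.exp (2 / t ^ 2) := by
      rw [← hfY, outerMap, hYt]
      have : (t : ℂ) * Complex.exp (2 / (t : ℂ) ^ 2) = ((t * Real.exp (2 / t ^ 2) : ℝ) : ℂ) := by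
        push_cast; ring
      rw [this, Complex.ofReal_re]
    have root : ∀ t : ℝ, 0 < t → ((2 * Complex.I / t) ^ 2) ^ (1 / 2 : ℂ) = 2 * Complex.I / t := by
      intro t ht
      have e : 2 * Complex.I / (t : ℂ) = ((2 / t : ℝ) : ℂ) * Complex.I := by push_cast; ring
      have harg : (2 * Complex.I / (t : ℂ)).arg = Real.pi / 2 := by
        rw [e, Complex.arg_real_mul _ (by positivity), Complex.arg_I]
      rw [half]
      refine Complex.pow_cpow_ofNat_inv (n := 2) ?_ ?_
      · rw [harg]
        have := Real.pi_pos
        simp only [OfNat.ofNat]; norm_num; linarith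
      · rw [harg]
    rw [sqrtLambert, hW]
    by_cases hneg' : z.re < 0
    -- Here $2i/t$ has argument $-\pi/2$, so the principal root is its negative and the sign in
    -- `sqrtLambert` corrects it.
    · rw [if_pos ⟨hz1.symm, hneg'⟩]
      have htn : t < 0 := by
        by_contra hge
        rw [not_lt] at hge
        have : 0 ≤ t * Real.exp (2 / t ^ 2) := by positivity
        linarith
      have := root (-t) (by linarith)
      rw [← hxsq, hYt]
      rw [show (2 * Complex.I / (t : ℂ)) ^ 2 = (2 * Complex.I / ((-t : ℝ) : ℂ)) ^ 2 by
        push_cast; ring, this]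
      push_cast; rw [div_neg, neg_neg]
    · rw [if_neg (fun h => hneg' h.2)]
      have htp : 0 < t := by
        rcases lt_or_gt_of_ne ht0 with h | h
        · exfalso
          have : t * Real.exp (2 / t ^ 2) < 0 := mul_neg_of_neg_of_pos h (Real.exp_pos _)
          exact hneg' (by linarith)
        · exact h
      rw [← hxsq, hYt]
      exact root t htp
  · have hYp : 0 < Y.im := by
      refine lt_of_le_of_ne hYim fun h0 => ?_
      have hYt : Y = (Y.re : ℂ) := Complex.ext (by simp) (by simp [← h0])
      have : (outerMap Y).im = 0 := by
        rw [outerMap, hYt]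
        have : (Y.re : ℂ) * Complex.exp (2 / (Y.re : ℂ) ^ 2)
          = ((Y.re * Real.exp (2 / Y.re ^ 2) : ℝ) : ℂ) := by push_cast; ring
        rw [this, Complex.ofReal_im]
      rw [hfY] at this; linarith
    rw [sqrtLambert, if_neg (fun h => hz1.ne' h.1), hW, ← hxsq, half]
    refine Complex.sq_cpow_two_inv ?_
    have : (2 * Complex.I / Y).re = 2 * Y.im / Complex.normSq Y := by
      rw [Complex.div_re]; simp
    rw [this]
    have := Complex.normSq_pos.2 hY0
    positivity

end Hull

/-! ### The characteristic vector field and its uniform estimates -/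

/-- The vector field driving the starting points of characteristics along a Loewner path. -/
def charField (ν : Measure ℝ) (σ : ℝ) (y : ℂ) : ℂ :=
  -greenFn ν y / (1 - 2 * σ * cauchySq ν y)

section Field

lemma norm_div_sub_div_le {N₁ N₂ D₁ D₂ : ℂ} {θ : ℝ} (hθ : 0 < θ) (h₁ : θ ≤ ‖D₁‖) (h₂ : θ ≤ ‖D₂‖) :
    ‖N₁ / D₁ - N₂ / D₂‖ ≤ ‖N₁ - N₂‖ / θ + ‖N₂‖ * ‖D₁ - D₂‖ / θ ^ 2 := by
  have d1 : D₁ ≠ 0 := norm_pos_iff.1 (hθ.trans_le h₁)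
  have d2 : D₂ ≠ 0 := norm_pos_iff.1 (hθ.trans_le h₂)
  have e : N₁ / D₁ - N₂ / D₂ = (N₁ - N₂) / D₁ - N₂ * (D₁ - D₂) / (D₁ * D₂) := by
    field_simp; ring
  rw [e]
  refine (norm_sub_le _ _).trans (add_le_add ?_ ?_)
  · rw [norm_div]; gcongr
  · rw [norm_div, norm_mul, norm_mul, pow_two]; gcongr

lemma FarFrom.of_norm {ν : Measure ℝ} {d e : ℝ} {z : ℂ} (hν : ∀ᵐ u : ℝ ∂ν, |u| ≤ e) (h : d + e ≤ ‖z‖) :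
    FarFrom ν d z := by
  filter_upwards [hν] with u hu
  have := norm_sub_norm_le z (u : ℂ)
  rw [Complex.norm_real, Real.norm_eq_abs] at this
  linarith

variable {ν : Measure ℝ} [IsProbabilityMeasure ν] {σ κ : ℝ} {x y : ℂ}

lemma le_norm_charField_denom (hσ : σ ∈ Icc (0 : ℝ) 1) (hκ : 0 < κ)
    (hx : FarFrom ν (2 * √σ + κ) x) : κ / (2 + κ) ≤ ‖1 - 2 * (σ : ℂ) * cauchySq ν x‖ := by
  have hD : 0 < 2 * √σ + κ := by positivity
  have h1 := norm_cauchySq_le hD hx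
  have h2 := four_mul_div_sq_le hσ.1 hκ
  have h3 : ‖2 * (σ : ℂ) * cauchySq ν x‖ ≤ 2 * σ * (2 / (2 * √σ + κ) ^ 2) := by
    rw [norm_mul, norm_mul, Complex.norm_real, Real.norm_eq_abs, abs_of_nonneg hσ.1,
      Complex.norm_ofNat]
    have := hσ.1
    gcongr
  have h4 : κ / (2 + κ) ≤ κ / (2 * √σ + κ) := by
    have : √σ ≤ 1 := Real.sqrt_le_one.2 hσ.2
    gcongr; linarith
  have h5 := norm_sub_norm_le (1 : ℂ) (2 * (σ : ℂ) * cauchySq ν x)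
  rw [norm_one] at h5
  linarith

lemma norm_charField_le (hσ : σ ∈ Icc (0 : ℝ) 1) (hκ : 0 < κ) (hx : FarFrom ν (2 * √σ + κ) x) :
    ‖charField ν σ x‖ ≤ 2 / κ / (κ / (2 + κ)) := by
  have h1 := le_norm_charField_denom hσ hκ hx
  have h2 := norm_greenFn_le hκ (hx.mono (by linarith [Real.sqrt_nonneg σ]))
  rw [charField, norm_div, norm_neg]
  gcongr

/-- A Lipschitz constant of `charField`, uniform over measures and times in `[0, 1]`. -/
def fieldConst (κ : ℝ) : ℝ :=
  2 / κ ^ 2 / (κ / (2 + κ)) + 2 / κ * (2 * (4 / κ ^ 3)) / (κ / (2 + κ)) ^ 2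

lemma fieldConst_pos (hκ : 0 < κ) : 0 < fieldConst κ := by
  unfold fieldConst; positivity

/-- Numerators and derivatives are left abstract so that one estimate covers both a change of point
and a change of measure. -/
lemma fieldConst_bound (hσ : σ ∈ Icc (0 : ℝ) 1) (hκ : 0 < κ) {N₁ N₂ C₁ C₂ : ℂ} {δ : ℝ}
    (h₁ : κ / (2 + κ) ≤ ‖1 - 2 * (σ : ℂ) * C₁‖) (h₂ : κ / (2 + κ) ≤ ‖1 - 2 * (σ : ℂ) * C₂‖)
    (hN : ‖N₁ - N₂‖ ≤ 2 / κ ^ 2 * δ) (hC : ‖C₁ - C₂‖ ≤ 4 / κ ^ 3 * δ) (hN2 : ‖N₂‖ ≤ 2 / κ) :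
    ‖-N₁ / (1 - 2 * (σ : ℂ) * C₁) - -N₂ / (1 - 2 * (σ : ℂ) * C₂)‖ ≤ fieldConst κ * δ := by
  have hθ : 0 < κ / (2 + κ) := by positivity
  refine (norm_div_sub_div_le hθ h₁ h₂).trans ?_
  have e1 : ‖-N₁ - -N₂‖ ≤ 2 / κ ^ 2 * δ := by
    rw [← norm_neg, show -(-N₁ - -N₂) = N₁ - N₂ by ring]; exact hN
  have e2 : ‖(1 - 2 * (σ : ℂ) * C₁) - (1 - 2 * (σ : ℂ) * C₂)‖ ≤ 2 * (4 / κ ^ 3 * δ) := by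
    rw [show (1 - 2 * (σ : ℂ) * C₁) - (1 - 2 * (σ : ℂ) * C₂) = -(2 * ((σ : ℂ) * (C₁ - C₂))) by ring,
      norm_neg, norm_mul, norm_mul, Complex.norm_real, Real.norm_eq_abs, abs_of_nonneg hσ.1,
      Complex.norm_ofNat]
    have : σ * ‖C₁ - C₂‖ ≤ 1 * ‖C₁ - C₂‖ := by gcongr; exact hσ.2
    linarith
  rw [norm_neg N₂]
  calc ‖-N₁ - -N₂‖ / (κ / (2 + κ)) + ‖N₂‖ * ‖(1 - 2 * (σ : ℂ) * C₁) - (1 - 2 * (σ : ℂ) * C₂)‖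
        / (κ / (2 + κ)) ^ 2
      ≤ 2 / κ ^ 2 * δ / (κ / (2 + κ)) + 2 / κ * (2 * (4 / κ ^ 3 * δ)) / (κ / (2 + κ)) ^ 2 := by
        gcongr
    _ = _ := by rw [fieldConst]; ring

lemma norm_charField_sub_le (hσ : σ ∈ Icc (0 : ℝ) 1) (hκ : 0 < κ)
    (hx : FarFrom ν (2 * √σ + κ) x) (hy : FarFrom ν (2 * √σ + κ) y) :
    ‖charField ν σ x - charField ν σ y‖ ≤ fieldConst κ * ‖x - y‖ := by
  have hx' : FarFrom ν κ x := hx.mono (by linarith [Real.sqrt_nonneg σ])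
  have hy' : FarFrom ν κ y := hy.mono (by linarith [Real.sqrt_nonneg σ])
  exact fieldConst_bound hσ hκ (le_norm_charField_denom hσ hκ hx)
    (le_norm_charField_denom hσ hκ hy) (norm_greenFn_sub_le hκ hx' hy')
    (norm_cauchySq_sub_le hκ hx' hy') (norm_greenFn_le hκ hy')

lemma greenFn_dirac (z : ℂ) : greenFn (Measure.dirac 0) z = 2 / z := by
  simp [greenFn]

lemma cauchySq_dirac (z : ℂ) : cauchySq (Measure.dirac 0) z = 2 / z ^ 2 := by
  simp [cauchySq]

lemma farFrom_dirac {d : ℝ} {z : ℂ} : FarFrom (Measure.dirac 0) d z ↔ d ≤ ‖z‖ := by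
  simp [FarFrom]

/-- The kernel $2/(z-u)$ is the Green's function of the point mass at the shifted point $z-u$, so
the Lipschitz bound in the point controls the change of measure. -/
lemma norm_greenFn_sub_dirac_le {d e : ℝ} (hd : 0 < d) (hν : ∀ᵐ u : ℝ ∂ν, |u| ≤ e) {z : ℂ}
    (h : d + e ≤ ‖z‖) :
    ‖greenFn ν z - greenFn (Measure.dirac 0) z‖ ≤ 2 / d ^ 2 * e := by
  have hfar := FarFrom.of_norm hν h
  have e1 : greenFn (Measure.dirac 0) z = ∫ _u : ℝ, greenFn (Measure.dirac 0) z ∂ν := by simp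
  rw [e1, greenFn, ← integral_sub (integrable_kernel hd hfar) (integrable_const _)]
  refine norm_integral_le_of_ae_le ?_
  filter_upwards [hν, hfar] with u hu hfu
  have he : 0 ≤ e := (abs_nonneg u).trans hu
  have := norm_greenFn_sub_le (ν := Measure.dirac 0) hd (a := z - u) (b := z)
    (farFrom_dirac.2 hfu) (farFrom_dirac.2 (by linarith))
  rw [greenFn_dirac (z - u)] at this
  refine this.trans ?_
  have e2 : ‖z - (u : ℂ) - z‖ = |u| := by simp
  rw [e2]; gcongr

lemma norm_cauchySq_sub_dirac_le {d e : ℝ} (hd : 0 < d) (hν : ∀ᵐ u : ℝ ∂ν, |u| ≤ e) {z : ℂ}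
    (h : d + e ≤ ‖z‖) :
    ‖cauchySq ν z - cauchySq (Measure.dirac 0) z‖ ≤ 4 / d ^ 3 * e := by
  have hfar := FarFrom.of_norm hν h
  have e1 : cauchySq (Measure.dirac 0) z = ∫ _u : ℝ, cauchySq (Measure.dirac 0) z ∂ν := by simp
  rw [e1, cauchySq, ← integral_sub (integrable_kernel_sq hd hfar) (integrable_const _)]
  refine norm_integral_le_of_ae_le ?_
  filter_upwards [hν, hfar] with u hu hfu
  have he : 0 ≤ e := (abs_nonneg u).trans hu
  have := norm_cauchySq_sub_le (ν := Measure.dirac 0) hd (a := z - u) (b := z)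
    (farFrom_dirac.2 hfu) (farFrom_dirac.2 (by linarith))
  rw [cauchySq_dirac (z - u)] at this
  refine this.trans ?_
  have e2 : ‖z - (u : ℂ) - z‖ = |u| := by simp
  rw [e2]; gcongr

lemma norm_charField_sub_dirac_le {e : ℝ} (hσ : σ ∈ Icc (0 : ℝ) 1) (hκ : 0 < κ) (he : 0 ≤ e)
    (hν : ∀ᵐ u : ℝ ∂ν, |u| ≤ e) (hx : 2 * √σ + κ + e ≤ ‖x‖) :
    ‖charField ν σ x - charField (Measure.dirac 0) σ x‖ ≤ fieldConst κ * e := by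
  have hs := Real.sqrt_nonneg σ
  exact fieldConst_bound hσ hκ
    (le_norm_charField_denom hσ hκ (FarFrom.of_norm hν hx))
    (le_norm_charField_denom hσ hκ (farFrom_dirac.2 (by linarith)))
    (norm_greenFn_sub_dirac_le hκ hν (by linarith))
    (norm_cauchySq_sub_dirac_le hκ hν (by linarith))
    (norm_greenFn_le hκ (farFrom_dirac.2 (by linarith)))

lemma continuousOn_greenFn {d : ℝ} (hd : 0 < d) : ContinuousOn (greenFn ν) {z | FarFrom ν d z} := by
  intro z hz
  exact (hasDerivAt_greenFn hd hz).continuousAt.continuousWithinAt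

lemma continuousOn_cauchySq {d : ℝ} (hd : 0 < d) :
    ContinuousOn (cauchySq ν) {z | FarFrom ν d z} := by
  have : LipschitzOnWith (4 / d ^ 3).toNNReal (cauchySq ν) {z | FarFrom ν d z} := by
    refine LipschitzOnWith.of_dist_le_mul fun a ha b hb => ?_
    rw [dist_eq_norm, dist_eq_norm, Real.coe_toNNReal _ (by positivity)]
    exact norm_cauchySq_sub_le hd ha hb
  exact this.continuousOn

lemma continuousOn_charField_comp (hκ : 0 < κ) {p : ℝ → ℂ} (hp : ContinuousOn p (Icc 0 1))
    (hfar : ∀ σ ∈ Icc (0 : ℝ) 1, FarFrom ν (2 * √σ + κ) (p σ)) :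
    ContinuousOn (fun σ => charField ν σ (p σ)) (Icc 0 1) := by
  have hm : MapsTo p (Icc 0 1) {z | FarFrom ν κ z} := fun σ hσ =>
    (hfar σ hσ).mono (by linarith [Real.sqrt_nonneg σ])
  have h1 := (continuousOn_greenFn (ν := ν) hκ).comp hp hm
  have h2 := (continuousOn_cauchySq (ν := ν) hκ).comp hp hm
  refine h1.neg.div (continuousOn_const.sub ((continuousOn_const.mul
    Complex.continuous_ofReal.continuousOn).mul h2)) fun σ hσ => ?_
  have := le_norm_charField_denom hσ hκ (hfar σ hσ)
  have h0 : 0 < κ / (2 + κ) := by positivity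
  exact norm_pos_iff.1 (h0.trans_le this)

end Field

/-! ### Truncation and stability of the characteristic equation -/

section Clamp

/-- The nearest-point retraction of the plane onto the square of half-width `c`. -/
def clamp (c : ℝ) (v : ℂ) : ℂ :=
  ((max (-c) (min c v.re) : ℝ) : ℂ) + ((max (-c) (min c v.im) : ℝ) : ℂ) * Complex.I

lemma norm_ofReal_add_le (a b : ℝ) : ‖(a : ℂ) + b * Complex.I‖ ≤ |a| + |b| := by
  refine (norm_add_le _ _).trans ?_
  simp

lemma norm_clamp_le {c : ℝ} (hc : 0 ≤ c) (v : ℂ) : ‖clamp c v‖ ≤ 2 * c := by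
  have h : ∀ x : ℝ, |max (-c) (min c x)| ≤ c := fun x =>
    abs_le.2 ⟨le_max_left _ _, max_le (by linarith) (min_le_left _ _)⟩
  refine (norm_ofReal_add_le _ _).trans ?_
  linarith [h v.re, h v.im]

lemma clamp_of_norm_le {c : ℝ} {v : ℂ} (h : ‖v‖ ≤ c) : clamp c v = v := by
  have h1 := abs_le.1 ((Complex.abs_re_le_norm v).trans h)
  have h2 := abs_le.1 ((Complex.abs_im_le_norm v).trans h)
  rw [clamp, min_eq_right h1.2, min_eq_right h2.2, max_eq_right h1.1, max_eq_right h2.1,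
    Complex.re_add_im]

lemma norm_clamp_sub_le (c : ℝ) (v w : ℂ) : ‖clamp c v - clamp c w‖ ≤ 2 * ‖v - w‖ := by
  have h : ∀ x y : ℝ, |max (-c) (min c x) - max (-c) (min c y)| ≤ |x - y| := fun x y => by
    rw [max_comm _ (min c x), max_comm _ (min c y), min_comm c x, min_comm c y]
    have h1 := abs_max_sub_max_le_abs (min x c) (min y c) (-c)
    have h2 := abs_min_sub_min_le_max x c y c
    simp only [sub_self, abs_zero] at h2
    exact h1.trans (h2.trans (max_le le_rfl (abs_nonneg _)))
  have e : clamp c v - clamp c w = ((max (-c) (min c v.re) - max (-c) (min c w.re) : ℝ) : ℂ)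
      + ((max (-c) (min c v.im) - max (-c) (min c w.im) : ℝ) : ℂ) * Complex.I := by
    simp only [clamp]; push_cast; ring
  rw [e]
  refine (norm_ofReal_add_le _ _).trans ?_
  have h1 := (h v.re w.re).trans (Complex.abs_re_le_norm (v - w))
  have h2 := (h v.im w.im).trans (Complex.abs_im_le_norm (v - w))
  linarith

lemma continuous_clamp (c : ℝ) : Continuous (clamp c) := by
  unfold clamp; fun_prop

end Clamp

/-- Continuous dependence of the characteristic equation on the measure and the starting point. -/
lemma exists_charField_path {Y : ℝ → ℂ} {κ : ℝ} (hκ : 0 < κ)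
    (hY : ∀ σ ∈ Icc (0 : ℝ) 1,
      HasDerivWithinAt Y (charField (Measure.dirac 0) σ (Y σ)) (Icc 0 1) σ)
    (hfar : ∀ σ ∈ Icc (0 : ℝ) 1, 2 * √σ + 4 * κ ≤ ‖Y σ‖) {η : ℝ} (hη : 0 < η) (hηκ : η ≤ κ) :
    ∃ δ > 0, ∀ (ν : Measure ℝ) [IsProbabilityMeasure ν], (∀ᵐ u : ℝ ∂ν, |u| ≤ δ) →
      ∀ x₀ : ℂ, ‖x₀ - Y 0‖ ≤ δ → ∃ y : ℝ → ℂ, y 0 = x₀ ∧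
        (∀ σ ∈ Icc (0 : ℝ) 1, HasDerivWithinAt y (charField ν σ (y σ)) (Icc 0 1) σ) ∧
        ∀ σ ∈ Icc (0 : ℝ) 1, ‖y σ - Y σ‖ ≤ η := by
  set K : ℝ := fieldConst κ * 2 with hK
  have hF := fieldConst_pos hκ
  have hK0 : 0 < K := by positivity
  -- Grönwall's bound at time $1$ for initial error `δ` and velocity error `fieldConst κ * δ` equals
  -- $A\delta$.
  set A : ℝ := Real.exp (K * 1) + fieldConst κ / K * (Real.exp (K * 1) - 1) with hA
  have hA0 : 0 < A := by
    have : 1 ≤ Real.exp (K * 1) := Real.one_le_exp (by positivity)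
    have h1 : 0 ≤ fieldConst κ / K * (Real.exp (K * 1) - 1) :=
      mul_nonneg (by positivity) (by linarith)
    positivity
  refine ⟨min κ (η / A), lt_min hκ (by positivity), ?_⟩
  set δ := min κ (η / A) with hδ
  have hδ0 : 0 < δ := lt_min hκ (by positivity)
  have hδκ : δ ≤ κ := min_le_left _ _
  have hδA : A * δ ≤ η := by
    have : δ ≤ η / A := min_le_right _ _
    rw [le_div_iff₀ hA0] at this; linarith
  intro ν _ hν x₀ hx₀
  have hYc : ContinuousOn Y (Icc 0 1) := fun σ hσ => (hY σ hσ).continuousWithinAt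
  -- Evaluating the field at the truncated point makes it globally Lipschitz, so Picard–Lindelöf
  -- reaches time $1$ in one step. The Grönwall estimate then shows that the truncation was never
  -- active.
  let P : ℝ → ℂ → ℂ := fun σ x => Y σ + clamp κ (x - Y σ)
  have hP : ∀ σ x, ‖P σ x - Y σ‖ ≤ 2 * κ := fun σ x => by
    simpa [P] using norm_clamp_le hκ.le (x - Y σ)
  have hPn : ∀ σ ∈ Icc (0 : ℝ) 1, ∀ x, 2 * √σ + κ + δ ≤ ‖P σ x‖ := fun σ hσ x => by
    have h1 := hfar σ hσ
    have h2 := norm_sub_norm_le (Y σ) (Y σ - P σ x)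
    rw [sub_sub_cancel, norm_sub_rev] at h2
    linarith [hP σ x]
  have hPfar : ∀ σ ∈ Icc (0 : ℝ) 1, ∀ x, FarFrom ν (2 * √σ + κ) (P σ x) := fun σ hσ x =>
    FarFrom.of_norm hν (hPn σ hσ x)
  have hPfar0 : ∀ σ ∈ Icc (0 : ℝ) 1, ∀ x, FarFrom (Measure.dirac 0) (2 * √σ + κ) (P σ x) :=
    fun σ hσ x => farFrom_dirac.2 (by linarith [hPn σ hσ x])
  have hPsub : ∀ σ x x', ‖P σ x - P σ x'‖ ≤ 2 * ‖x - x'‖ := fun σ x x' => by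
    have := norm_clamp_sub_le κ (x - Y σ) (x' - Y σ)
    simpa [P] using this
  have hlip : ∀ (ν : Measure ℝ) [IsProbabilityMeasure ν] (σ : ℝ), σ ∈ Icc (0 : ℝ) 1 →
      (∀ x, FarFrom ν (2 * √σ + κ) (P σ x)) →
      LipschitzWith K.toNNReal (fun x => charField ν σ (P σ x)) := by
    intro ν _ σ hσ hf
    refine LipschitzWith.of_dist_le_mul fun x x' => ?_
    rw [dist_eq_norm, dist_eq_norm, Real.coe_toNNReal _ hK0.le]
    refine (norm_charField_sub_le hσ hκ (hf x) (hf x')).trans ?_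
    have := hPsub σ x x'
    rw [hK, mul_assoc]
    gcongr
  set B : ℝ := 2 / κ / (κ / (2 + κ)) with hB
  have hB0 : 0 ≤ B := by positivity
  have hPL : IsPicardLindelof (fun σ x => charField ν σ (P σ x))
      (⟨0, by simp⟩ : Icc (0 : ℝ) 1) x₀ B.toNNReal 0 B.toNNReal K.toNNReal := by
    refine ⟨fun σ hσ => (hlip ν σ hσ (hPfar σ hσ)).lipschitzOnWith, fun x _ => ?_,
      fun σ hσ x _ => ?_, ?_⟩
    · refine continuousOn_charField_comp hκ ?_ (fun σ hσ => hPfar σ hσ x)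
      exact hYc.add ((continuous_clamp κ).comp_continuousOn (continuousOn_const.sub hYc))
    · rw [Real.coe_toNNReal _ hB0]
      exact norm_charField_le hσ hκ (hPfar σ hσ x)
    · simp
  obtain ⟨y, hy0, hy⟩ := hPL.exists_eq_forall_mem_Icc_hasDerivWithinAt₀
  have hyc : ContinuousOn y (Icc 0 1) := fun σ hσ => (hy σ hσ).continuousWithinAt
  have right : ∀ {f : ℝ → ℂ} {f' : ℂ} {σ : ℝ}, σ ∈ Ico (0 : ℝ) 1 →
      HasDerivWithinAt f f' (Icc 0 1) σ → HasDerivWithinAt f f' (Ici σ) σ := fun hσ h =>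
    h.mono_of_mem_nhdsWithin (mem_of_superset (Icc_mem_nhdsGE hσ.2) (Icc_subset_Icc_left hσ.1))
  have hclose : ∀ σ ∈ Icc (0 : ℝ) 1, ‖y σ - Y σ‖ ≤ η := by
    intro σ hσ
    have hg := dist_le_of_approx_trajectories_ODE_of_mem (a := 0) (b := 1) (K := K.toNNReal)
      (v := fun σ x => charField (Measure.dirac 0) σ (P σ x)) (s := fun _ => univ)
      (f := y) (g := Y) (f' := fun σ => charField ν σ (P σ (y σ)))
      (g' := fun σ => charField (Measure.dirac 0) σ (Y σ)) (εf := fieldConst κ * δ) (εg := 0)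
      (δ := δ)
      (fun σ hσ => (hlip _ σ ⟨hσ.1, hσ.2.le⟩ (hPfar0 σ ⟨hσ.1, hσ.2.le⟩)).lipschitzOnWith)
      hyc (fun σ hσ => right hσ (hy σ ⟨hσ.1, hσ.2.le⟩))
      (fun σ hσ => by
        rw [dist_eq_norm]
        exact norm_charField_sub_dirac_le ⟨hσ.1, hσ.2.le⟩ hκ hδ0.le hν (hPn σ ⟨hσ.1, hσ.2.le⟩ _))
      (fun _ _ => trivial) hYc (fun σ hσ => right hσ (hY σ ⟨hσ.1, hσ.2.le⟩))
      (fun σ hσ => by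
        have : P σ (Y σ) = Y σ := by
          simp only [P, sub_self]; rw [clamp_of_norm_le (by simpa using hκ.le), add_zero]
        simp only [this]
        rw [dist_self])
      (fun _ _ => trivial) (by rw [dist_eq_norm]; rw [show y 0 = x₀ from hy0]; exact hx₀) σ hσ
    rw [dist_eq_norm, add_zero, sub_zero, Real.coe_toNNReal _ hK0.le] at hg
    refine hg.trans (le_trans (gronwallBound_mono hδ0.le (by positivity) hK0.le hσ.2) ?_)
    rw [gronwallBound_of_K_ne_0 hK0.ne']
    refine le_trans (le_of_eq ?_) hδA
    rw [hA]; ring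
  refine ⟨y, hy0, fun σ hσ => ?_, hclose⟩
  have : P σ (y σ) = y σ := by
    simp only [P]
    rw [clamp_of_norm_le ((hclose σ hσ).trans hηκ)]; ring
  have h := hy σ hσ
  simp only [this] at h
  exact h

/-! ### The explicit path for the point mass -/

/-- The path of characteristic starting points for the limiting (semicircular) flow. -/
lemma exists_limitPath {z : ℂ} (hz : 0 ≤ z.im) (hzK : z ∉ universalHull) :
    ∃ (Y : ℝ → ℂ) (w : ℂ) (κ : ℝ), 0 < κ ∧ ‖w‖ < 1 ∧ w * Complex.exp w = -4 / z ^ 2 ∧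
      Y 0 = z ∧ Y 1 = z * Complex.exp (w / 2) ∧
      (∀ σ ∈ Icc (0 : ℝ) 1,
        HasDerivWithinAt Y (charField (Measure.dirac 0) σ (Y σ)) (Icc 0 1) σ) ∧
      ∀ σ ∈ Icc (0 : ℝ) 1, 2 * √σ + 4 * κ ≤ ‖Y σ‖ := by
  have hz0 : z ≠ 0 := fun h => hzK (h ▸ zero_mem_universalHull)
  set ξ := -4 / z ^ 2 with hξ
  have hz2 : z ^ 2 ≠ 0 := pow_ne_zero 2 hz0
  choose! w hw hwe using fun (s : ℝ) (hs : s ∈ Icc (0 : ℝ) 1) => exists_lambert hz hzK hs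
  -- The chosen solutions carry no regularity of their own; injectivity in the unit disc identifies
  -- them locally with a differentiable inverse branch.
  have hder : ∀ σ ∈ Icc (0 : ℝ) 1,
      HasDerivWithinAt w (ξ * ((1 + w σ) * Complex.exp (w σ))⁻¹) (Icc 0 1) σ := by
    intro σ hσ
    have hs := hasStrictDerivAt_mul_exp (w σ)
    have hne := mul_exp_deriv_ne_zero (hw σ hσ)
    set g := hs.localInverse _ _ _ hne with hg
    have hgd := hs.to_localInverse hne
    rw [← hg] at hgd
    have hgw : g (w σ * Complex.exp (w σ)) = w σ :=
      (hs.hasStrictFDerivAt_equiv hne).localInverse_apply_image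
    have e1 : ∀ᶠ x in 𝓝 (w σ * Complex.exp (w σ)), g x * Complex.exp (g x) = x :=
      (hs.hasStrictFDerivAt_equiv hne).eventually_right_inverse
    have e2 : ∀ᶠ x in 𝓝 (w σ * Complex.exp (w σ)), g x ∈ Metric.ball (0 : ℂ) 1 := by
      refine hgd.hasDerivAt.continuousAt.preimage_mem_nhds (Metric.isOpen_ball.mem_nhds ?_)
      simpa [hgw] using hw σ hσ
    have hlin : HasDerivAt (fun s : ℝ => (s : ℂ) * ξ) ξ σ := by
      simpa using (Complex.ofRealCLM.hasDerivAt (x := σ)).mul_const ξ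
    rw [hwe σ hσ] at e1 e2 hgd
    have e3 := hlin.continuousAt.eventually (e1.and e2)
    have hc : HasDerivAt (fun s : ℝ => g (s * ξ)) (ξ * ((1 + w σ) * Complex.exp (w σ))⁻¹) σ := by
      have := hgd.hasDerivAt.scomp σ hlin
      simpa [Function.comp_def] using this
    refine hc.hasDerivWithinAt.congr_of_eventuallyEq ?_ ?_
    · filter_upwards [nhdsWithin_le_nhds e3, self_mem_nhdsWithin] with s hs' hsI
      refine lambert_injective_ball (hw s hsI) (by simpa using hs'.2) ?_
      rw [hwe s hsI, hs'.1]
    · rw [← hwe σ hσ, hgw]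
  set Y : ℝ → ℂ := fun σ => z * Complex.exp (w σ / 2) with hYd
  have hY0 : ∀ σ, Y σ ≠ 0 := fun σ => mul_ne_zero hz0 (Complex.exp_ne_zero _)
  have hY2 : ∀ σ, Y σ ^ 2 = z ^ 2 * Complex.exp (w σ) := fun σ => by
    simp only [hYd]; rw [mul_pow, ← Complex.exp_nat_mul]; congr 2; push_cast; ring
  -- This identity turns $|w|<1$ into $|Y|>2\sqrt\sigma$ and $1+w$ into the denominator of
  -- `charField`.
  have hwY : ∀ σ ∈ Icc (0 : ℝ) 1, w σ = -(4 * σ) / Y σ ^ 2 := fun σ hσ => by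
    rw [hY2, eq_div_iff (mul_ne_zero hz2 (Complex.exp_ne_zero _))]
    have := hwe σ hσ
    rw [mul_div_assoc', eq_div_iff hz2] at this
    linear_combination this
  have hYder : ∀ σ ∈ Icc (0 : ℝ) 1,
      HasDerivWithinAt Y (charField (Measure.dirac 0) σ (Y σ)) (Icc 0 1) σ := by
    intro σ hσ
    have h1 := ((hder σ hσ).div_const 2).cexp.const_mul z
    refine h1.congr_deriv ?_
    have h1w : 1 + w σ ≠ 0 := left_ne_zero_of_mul (mul_exp_deriv_ne_zero (hw σ hσ))
    have hden : 1 - 2 * (σ : ℂ) * (2 / Y σ ^ 2) = 1 + w σ := by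
      rw [hwY σ hσ]; ring
    rw [charField, greenFn_dirac, cauchySq_dirac, hden]
    have e : z * (Complex.exp (w σ / 2) * (ξ * ((1 + w σ) * Complex.exp (w σ))⁻¹ / 2))
        = Y σ * (ξ * ((1 + w σ) * Complex.exp (w σ))⁻¹ / 2) := by simp only [hYd]; ring
    rw [e]
    have hexp : Complex.exp (w σ) = Y σ ^ 2 / z ^ 2 := by rw [hY2]; field_simp
    rw [hexp, hξ]
    have := hY0 σ
    field_simp
    norm_num
  have hlt : ∀ σ ∈ Icc (0 : ℝ) 1, 0 < ‖Y σ‖ - 2 * √σ := by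
    intro σ hσ
    have h1 := hw σ hσ
    have hYn := norm_pos_iff.2 (hY0 σ)
    rw [hwY σ hσ, norm_div, norm_neg, norm_mul, norm_pow, Complex.norm_real, Real.norm_eq_abs,
      abs_of_nonneg hσ.1, div_lt_one (by positivity), Complex.norm_ofNat] at h1
    have h2 := Real.sq_sqrt hσ.1
    nlinarith [Real.sqrt_nonneg σ]
  have hcont : ContinuousOn (fun σ => ‖Y σ‖ - 2 * √σ) (Icc 0 1) :=
    ContinuousOn.sub (ContinuousOn.norm fun σ hσ => (hYder σ hσ).continuousWithinAt) (by fun_prop)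
  obtain ⟨σm, hσm, hmin⟩ := isCompact_Icc.exists_isMinOn ⟨0, by simp⟩ hcont
  refine ⟨Y, w 1, (‖Y σm‖ - 2 * √σm) / 4, by linarith [hlt σm hσm], hw 1 (by simp), ?_, ?_, rfl,
    hYder, fun σ hσ => ?_⟩
  · have := hwe 1 (by simp)
    simpa using this
  · have h0 := hwY 0 (by simp)
    simp only [Complex.ofReal_zero, mul_zero, neg_zero, zero_div] at h0
    simp [hYd, h0]
  · have := hmin hσ
    simp only [mem_ofPred_eq] at this
    linarith

/-! ### From characteristic starting points to Loewner paths -/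

section Construction

variable {μ₀ : ProbabilityMeasure ℝ} {μ : ℝ → ProbabilityMeasure ℝ}

lemma FarFrom.notMem_support {ν : Measure ℝ} {d x : ℝ} (hd : 0 < d) (h : FarFrom ν d (x : ℂ)) :
    x ∉ ν.support := by
  rw [Measure.notMem_support_iff_exists]
  refine ⟨Metric.ball x d, Metric.ball_mem_nhds x hd, ?_⟩
  rw [measure_eq_zero_iff_ae_notMem]
  filter_upwards [h] with u hu hmem
  rw [Metric.mem_ball, Real.dist_eq, abs_sub_comm] at hmem
  rw [← Complex.ofReal_sub, Complex.norm_real, Real.norm_eq_abs] at hu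
  linarith

/-- Moving the starting points of characteristics along `charField` produces a Loewner path. -/
lemma isLoewnerPath_charMap (hμ : IsHydrodynamicLimit μ₀ μ) {ζ : ℝ → ℂ} {T κ : ℝ} (hT : 0 ≤ T)
    (hκ : 0 < κ) (h0 : 0 ≤ (ζ 0).im)
    (hζ : ∀ s ∈ Icc 0 T, HasDerivWithinAt ζ (charField μ₀ s (ζ s)) (Icc 0 T) s)
    (hfar : ∀ s ∈ Icc 0 T, FarFrom μ₀ (2 * √s + 2 * κ) (ζ s)) :
    IsLoewnerPath μ (ζ 0) T (fun s => charMap μ₀ s (ζ s)) ∧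
      ∃ r > 0, ∀ s ∈ Icc 0 T, FarFrom (μ s) (2 * r) (charMap μ₀ s (ζ s)) := by
  have hfarκ : ∀ s ∈ Icc 0 T, FarFrom μ₀ (2 * √s + κ) (ζ s) := fun s hs =>
    (hfar s hs).mono (by linarith)
  have hfar1 : ∀ s ∈ Icc 0 T, FarFrom μ₀ κ (ζ s) := fun s hs =>
    (hfar s hs).mono (by linarith [Real.sqrt_nonneg s])
  set γ : ℝ → ℂ := fun s => charMap μ₀ s (ζ s) with hγ
  have hγ0 : γ 0 = ζ 0 := by simp [hγ, charMap]
  set θ := κ / (2 * √T + κ) with hθ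
  have hθ0 : 0 < θ := by positivity
  have hθle : ∀ s ∈ Icc 0 T, θ ≤ κ / (2 * √s + κ) := fun s hs => by
    have := Real.sqrt_le_sqrt hs.2
    rw [hθ]; gcongr
  -- Differentiating $\zeta+2sM_0(\zeta)$ gives $2M_0+\zeta'(1-2s\,$`cauchySq`$)$, and `charField`
  -- is chosen so that the last term is $-M_0$.
  have hder : ∀ s ∈ Icc 0 T, HasDerivWithinAt γ (greenFn μ₀ (ζ s)) (Icc 0 T) s := by
    intro s hs
    have h1 := hζ s hs
    have h2 := (hasDerivAt_greenFn hκ (hfar1 s hs)).scomp_hasDerivWithinAt s h1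
    have h3 : HasDerivWithinAt (fun s : ℝ => 2 * (s : ℂ)) 2 (Icc 0 T) s := by
      simpa using ((Complex.ofRealCLM.hasDerivAt (x := s)).const_mul (2 : ℂ)).hasDerivWithinAt
    have h4 := h1.add (h3.mul h2)
    refine h4.congr_deriv ?_
    have hne : 1 - 2 * (s : ℂ) * cauchySq μ₀ (ζ s) ≠ 0 := by
      have hb := norm_cauchySq_le (by positivity) (hfarκ s hs)
      have h2 := four_mul_div_sq_le hs.1 hκ
      have h3 : ‖2 * (s : ℂ) * cauchySq μ₀ (ζ s)‖ ≤ 2 * s * (2 / (2 * √s + κ) ^ 2) := by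
        rw [norm_mul, norm_mul, Complex.norm_real, Real.norm_eq_abs, abs_of_nonneg hs.1,
          Complex.norm_ofNat]
        have := hs.1
        gcongr
      intro hz
      have : 2 * (s : ℂ) * cauchySq μ₀ (ζ s) = 1 := by linear_combination -hz
      rw [this, norm_one] at h3
      have := hθle s hs
      linarith
    have hc : charField μ₀ s (ζ s) * (1 - 2 * (s : ℂ) * cauchySq μ₀ (ζ s)) = -greenFn μ₀ (ζ s) := by
      rw [charField, div_mul_cancel₀ _ hne]
    simp only [Function.comp_apply, smul_eq_mul]
    linear_combination hc
  have hγc : ContinuousOn γ (Icc 0 T) := fun s hs => (hder s hs).continuousWithinAt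
  have him : ∀ s ∈ Icc 0 T, (γ s).im = (ζ s).im * (1 - 2 * s * poissonInt μ₀ (ζ s)) := fun s hs =>
    charMap_im hκ (hfarκ s hs)
  have hfac : ∀ s ∈ Icc 0 T, θ ≤ 1 - 2 * s * poissonInt μ₀ (ζ s) := fun s hs =>
    (hθle s hs).trans (le_one_sub_poissonInt hs.1 hκ (hfarκ s hs))
  have hfder : ∀ s ∈ Icc 0 T,
      HasDerivWithinAt (fun s => (γ s).im) (greenFn μ₀ (ζ s)).im (Icc 0 T) s := fun s hs =>
    (Complex.imCLM.hasFDerivAt.comp_hasDerivWithinAt s (hder s hs))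
  have hfb : ∀ s ∈ Icc 0 T, ‖(greenFn μ₀ (ζ s)).im‖ ≤ 2 / κ ^ 2 / θ * ‖(γ s).im‖ := by
    intro s hs
    rw [greenFn_im hκ (hfar1 s hs), him s hs, norm_mul, norm_mul, norm_neg,
      Real.norm_of_nonneg (poissonInt_nonneg _ _),
      Real.norm_of_nonneg (hθ0.le.trans (hfac s hs))]
    have h1 := poissonInt_le hκ (hfar1 s hs)
    have h2 := hfac s hs
    calc ‖(ζ s).im‖ * poissonInt μ₀ (ζ s) ≤ ‖(ζ s).im‖ * (2 / κ ^ 2) := by gcongr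
      _ = 2 / κ ^ 2 / θ * (‖(ζ s).im‖ * θ) := by field_simp
      _ ≤ _ := by gcongr
  -- The derivative of $\operatorname{Im}\gamma$ is bounded by a multiple of
  -- $|\operatorname{Im}\gamma|$, so a single zero makes it vanish identically. Real paths stay real
  -- and paths in the upper half-plane never reach the line.
  have hzero : ∀ s₁ ∈ Icc 0 T, (γ s₁).im = 0 → ∀ s ∈ Icc 0 T, (γ s).im = 0 := fun s₁ hs₁ h =>
    eq_zero_of_norm_deriv_le (h := fun s => (γ s).im) hs₁ h hfder hfb
  have h0T : (0 : ℝ) ∈ Icc 0 T := ⟨le_rfl, hT⟩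
  have hfc : ContinuousOn (fun s => (γ s).im) (Icc 0 T) :=
    Complex.continuous_im.comp_continuousOn hγc
  have hζsign : ∀ s ∈ Icc 0 T, 0 < (γ s).im → 0 < (ζ s).im := fun s hs h => by
    rw [him s hs] at h
    exact (mul_pos_iff_of_pos_right (hθ0.trans_le (hfac s hs))).1 h
  rcases h0.eq_or_lt with hz | hz
  · have hall := hzero 0 h0T (by rw [hγ0, ← hz])
    have hζr : ∀ s ∈ Icc 0 T, (ζ s).im = 0 := fun s hs => by
      have := hall s hs
      rw [him s hs, mul_eq_zero] at this
      exact this.resolve_right (hθ0.trans_le (hfac s hs)).ne'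
    have hreal := fun s (hs : s ∈ Icc 0 T) =>
      real_characteristic hμ hs.1 hκ (hfar s hs) (hζr s hs)
    have hunif : ∀ s ∈ Icc 0 T, FarFrom (μ s) (2 * (θ * κ / 4)) (γ s) := fun s hs => by
      refine (hreal s hs).1.mono ?_
      have := hθle s hs
      have : θ * κ ≤ κ / (2 * √s + κ) * κ := by gcongr
      linarith
    refine ⟨⟨h0, hγ0, fun s hs => ?_, fun h => absurd h (by linarith), fun _ s hs => ?_⟩,
      θ * κ / 4, by positivity, hunif⟩
    · rw [(hreal s hs).2]; exact hder s hs
    · refine ⟨hall s hs, FarFrom.notMem_support (d := 2 * (θ * κ / 4)) (by positivity) ?_⟩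
      have e : ((γ s).re : ℂ) = γ s := Complex.ext (by simp) (by simp [hall s hs])
      rw [e]; exact hunif s hs
  · have hpos : ∀ s ∈ Icc 0 T, 0 < (γ s).im := by
      intro s hs
      by_contra hneg
      rw [not_lt] at hneg
      have hsub : Icc 0 s ⊆ Icc 0 T := Icc_subset_Icc_right hs.2
      obtain ⟨s₁, hs₁, e⟩ := intermediate_value_Icc' hs.1 (hfc.mono hsub)
        ⟨hneg, by rw [hγ0]; exact hz.le⟩
      have := hzero s₁ (hsub hs₁) e 0 h0T
      rw [hγ0] at this; linarith
    obtain ⟨sm, hsm, hmin⟩ := isCompact_Icc.exists_isMinOn ⟨0, h0T⟩ hfc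
    refine ⟨⟨h0, hγ0, fun s hs => ?_, fun _ => hpos, fun h => absurd h hz.ne'⟩,
      (γ sm).im / 2, by linarith [hpos sm hsm], fun s hs => ?_⟩
    · have : greenFn (μ s : Measure ℝ) (γ s) = greenFn μ₀ (ζ s) :=
        greenFn_charMap_of_im_pos hμ hs.1 (hζsign s hs (hpos s hs)) (hpos s hs)
      rw [this]; exact hder s hs
    · refine (farFrom_im _ _).mono ?_
      have := hmin hs
      simp only [mem_ofPred_eq] at this
      rw [abs_of_pos (hpos s hs)]; linarith

/-- Loewner paths that keep away from the supports are unique. -/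
lemma loewnerPath_unique {z : ℂ} {T r : ℝ} {γ γ₂ : ℝ → ℂ} (h : IsLoewnerPath μ z T γ)
    (h₂ : IsLoewnerPath μ z T γ₂) (hr : 0 < r) (hfar : ∀ s ∈ Icc 0 T, FarFrom (μ s) (2 * r) (γ s)) :
    ∀ s ∈ Icc 0 T, γ s = γ₂ s := by
  have hc : ContinuousOn γ (Icc 0 T) := fun s hs => (h.ode s hs).continuousWithinAt
  have hc₂ : ContinuousOn γ₂ (Icc 0 T) := fun s hs => (h₂.ode s hs).continuousWithinAt
  have hclosed : IsClosed ({s | γ s = γ₂ s} ∩ Icc 0 T) := by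
    have := (hc.prodMk hc₂).preimage_isClosed_of_isClosed isClosed_Icc isClosed_diagonal
    convert this using 1
    ext s; simp [and_comm]
  refine hclosed.Icc_subset_of_forall_mem_nhdsWithin ?_ ?_
  · change γ 0 = γ₂ 0
    rw [h.initial, h₂.initial]
  rintro x ⟨hx, hxI⟩
  have hxI' : x ∈ Icc 0 T := ⟨hxI.1, hxI.2.le⟩
  -- Only `γ` is assumed far from the supports; while `γ₂` is within `r` of it, `γ₂` is far as well
  -- and the Lipschitz estimate applies.
  have hnear : ∀ᶠ s in 𝓝[Icc 0 T] x, ‖γ₂ s - γ s‖ < r := by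
    have : ContinuousWithinAt (fun s => ‖γ₂ s - γ s‖) (Icc 0 T) x :=
      ((hc₂ x hxI').sub (hc x hxI')).norm
    refine this.tendsto.eventually (gt_mem_nhds ?_)
    rw [show γ x = γ₂ x from hx, sub_self, norm_zero]; exact hr
  have hle : 𝓝[≥] x ≤ 𝓝[Icc 0 T] x :=
    nhdsWithin_le_iff.2 (mem_of_superset (Icc_mem_nhdsGE hxI.2) (Icc_subset_Icc_left hxI.1))
  obtain ⟨b, hb, hsub⟩ := (mem_nhdsGE_iff_exists_Icc_subset).1
    (Filter.inter_mem (hle hnear) (Icc_mem_nhdsGE hxI.2))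
  have hbx : x < b := hb
  have hI : ∀ s ∈ Icc x b, s ∈ Icc 0 T := fun s hs =>
    ⟨hxI.1.trans (hsub hs).2.1, (hsub hs).2.2⟩
  have key := eq_zero_of_abs_deriv_le_mul_abs_self_of_eq_zero_right
    (f := fun s => γ s - γ₂ s)
    (f' := fun s => greenFn (μ s : Measure ℝ) (γ s) - greenFn (μ s : Measure ℝ) (γ₂ s))
    (K := 2 / r ^ 2) (a := x) (b := b)
    ((hc.mono hI).sub (hc₂.mono hI)) ?_ (sub_eq_zero.2 hx) ?_
  · refine mem_of_superset (Ioc_mem_nhdsGT hbx) fun s hs => ?_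
    exact sub_eq_zero.1 (key s ⟨hs.1.le, hs.2⟩)
  · intro s hs
    have hs' := hI s ⟨hs.1, hs.2.le⟩
    have hbT := (hI b ⟨hbx.le, le_rfl⟩).2
    exact ((h.ode s hs').sub (h₂.ode s hs')).mono_of_mem_nhdsWithin
      (mem_of_superset (Icc_mem_nhdsGE (hs.2.trans_le hbT)) (Icc_subset_Icc_left hs'.1))
  · intro s hs
    have hs' := hI s ⟨hs.1, hs.2.le⟩
    have hd : ‖γ₂ s - γ s‖ < r := (hsub ⟨hs.1, hs.2.le⟩).1
    exact norm_greenFn_sub_le hr ((hfar s hs').mono (by linarith))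
      (((hfar s hs').of_dist hd.le).mono (by linarith))

lemma loewnerMap_eq {z : ℂ} {T r : ℝ} {γ : ℝ → ℂ} (hT : 0 ≤ T) (h : IsLoewnerPath μ z T γ)
    (hr : 0 < r) (hfar : ∀ s ∈ Icc 0 T, FarFrom (μ s) (2 * r) (γ s)) :
    loewnerMap μ T z = γ T := by
  have hex : ∃ γ : ℝ → ℂ, IsLoewnerPath μ z T γ := ⟨γ, h⟩
  rw [loewnerMap, dif_pos hex]
  exact (loewnerPath_unique h hex.choose_spec hr hfar T ⟨hT, le_rfl⟩).symm

end Construction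

/-! ### Rescaling of measures -/

section Scaling

variable {ν : Measure ℝ} {c : ℝ}

/-- The image of a measure under the contraction by the factor `c`. -/
def shrink (ν : Measure ℝ) (c : ℝ) : Measure ℝ := ν.map fun u => u / c

lemma measurableEmbedding_div (hc : 0 < c) : MeasurableEmbedding fun u : ℝ => u / c := by
  simpa [div_eq_mul_inv] using
    (Homeomorph.mulRight₀ c⁻¹ (inv_ne_zero hc.ne')).measurableEmbedding

instance [IsProbabilityMeasure ν] : IsProbabilityMeasure (shrink ν c) :=
  Measure.isProbabilityMeasure_map (by fun_prop)

lemma ae_shrink_abs_le {L : ℝ} (hc : 0 < c) (h : ∀ᵐ u ∂ν, |u| ≤ L) :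
    ∀ᵐ u ∂(shrink ν c), |u| ≤ L / c := by
  rw [shrink, (measurableEmbedding_div hc).ae_map_iff]
  filter_upwards [h] with u hu
  rw [abs_div, abs_of_pos hc]; gcongr

lemma greenFn_scale (hc : 0 < c) (y : ℂ) : greenFn ν (c * y) = greenFn (shrink ν c) y / c := by
  rw [greenFn, greenFn, shrink, (measurableEmbedding_div hc).integral_map, ← integral_div]
  congr 1; ext u
  have : (c : ℂ) ≠ 0 := by exact_mod_cast hc.ne'
  push_cast
  rw [div_div, show (y - (u : ℂ) / c) * c = c * y - u by field_simp]

lemma cauchySq_scale (hc : 0 < c) (y : ℂ) :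
    cauchySq ν (c * y) = cauchySq (shrink ν c) y / c ^ 2 := by
  rw [cauchySq, cauchySq, shrink, (measurableEmbedding_div hc).integral_map, ← integral_div]
  congr 1; ext u
  have : (c : ℂ) ≠ 0 := by exact_mod_cast hc.ne'
  push_cast
  rw [div_div, ← mul_pow, show (y - (u : ℂ) / c) * c = c * y - u by field_simp]

lemma FarFrom.scale {d : ℝ} {y : ℂ} (hc : 0 < c) (h : FarFrom (shrink ν c) d y) :
    FarFrom ν (c * d) (c * y) := by
  rw [FarFrom, shrink, (measurableEmbedding_div hc).ae_map_iff] at h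
  filter_upwards [h] with u hu
  have hc' : (c : ℂ) ≠ 0 := by exact_mod_cast hc.ne'
  have e : (c : ℂ) * y - u = c * (y - ((u / c : ℝ) : ℂ)) := by push_cast; field_simp
  rw [e, norm_mul, Complex.norm_real, Real.norm_eq_abs, abs_of_pos hc]
  gcongr

end Scaling

/-! ### Convergence outside $\mathcal K$ -/

section Asymptotics

variable {μ₀ : ProbabilityMeasure ℝ} {μ : ℝ → ProbabilityMeasure ℝ}

/-- The Loewner map near a point outside the universal hull, uniformly in the starting point. -/
lemma loewner_outside (hμ : IsHydrodynamicLimit μ₀ μ) {L : ℝ}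
    (hL : ∀ᵐ u : ℝ ∂(μ₀ : Measure ℝ), |u| ≤ L) {z : ℂ} (hz : 0 ≤ z.im)
    (hzK : z ∉ universalHull) {η : ℝ} (hη : 0 < η) :
    ∃ δ > 0, ∃ T₀ > 0, ∀ t ≥ T₀, ∀ z' : ℂ, 0 ≤ z'.im → ‖z' - z‖ ≤ δ →
      (√t : ℂ) * z' ∈ loewnerDomain μ t ∧
      ‖1 / (√t : ℂ) * loewnerMap μ t ((√t : ℂ) * z') -
        2 * Complex.I * (1 / sqrtLambert z - sqrtLambert z)‖ ≤ η := by
  have hz0 : z ≠ 0 := fun h => hzK (h ▸ zero_mem_universalHull)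
  obtain ⟨Y, w, κ, hκ, hw, hwe, hY0, hY1, hYd, hYfar⟩ := exists_limitPath hz hzK
  -- The final error is at most $\eta'+2(2\kappa^{-2}\eta'+2\kappa^{-2}\eta')$: displacement of the
  -- point, change of measure, and change of point in the Green's function.
  set C : ℝ := 1 + 8 / κ ^ 2 with hC
  have hC0 : 0 < C := by positivity
  set η' := min κ (η / C) with hη'
  have hη'0 : 0 < η' := lt_min hκ (by positivity)
  have hη'C : C * η' ≤ η := by
    have : η' ≤ η / C := min_le_right _ _
    rw [le_div_iff₀ hC0] at this; linarith
  obtain ⟨δ₀, hδ₀, hpath⟩ := exists_charField_path hκ hYd hYfar hη'0 (min_le_left _ _)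
  set δ := min δ₀ η' with hδ
  have hδ0 : 0 < δ := lt_min hδ₀ hη'0
  -- The time threshold makes $L/\sqrt t\le\delta$, so the rescaled measure is concentrated within
  -- `δ` of the origin.
  refine ⟨δ, hδ0, max 1 ((L / δ) ^ 2), one_pos.trans_le (le_max_left _ _), fun t ht z' hz' hzz => ?_⟩
  have ht1 : 1 ≤ t := (le_max_left _ _).trans ht
  have ht0 : 0 < t := by linarith
  set c := √t with hc
  have hc0 : 0 < c := Real.sqrt_pos.2 ht0
  have hcC : (c : ℂ) ≠ 0 := by exact_mod_cast hc0.ne'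
  have hcc : c ^ 2 = t := Real.sq_sqrt ht0.le
  have hLc : L / c ≤ δ := by
    rw [div_le_comm₀ hc0 hδ0]
    exact Real.le_sqrt_of_sq_le ((le_max_right _ _).trans ht)
  have hν : ∀ᵐ u ∂(shrink μ₀ c), |u| ≤ δ :=
    (ae_shrink_abs_le hc0 hL).mono fun u hu => hu.trans hLc
  obtain ⟨y, hy0, hyd, hyY⟩ := hpath (shrink μ₀ c)
    (hν.mono fun u hu => hu.trans (min_le_left _ _)) z'
    (by rw [hY0]; exact hzz.trans (min_le_left _ _))
  have hδκ : δ ≤ κ := (min_le_right _ _).trans (min_le_left _ _)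
  have hη'κ : η' ≤ κ := min_le_left _ _
  have hyn : ∀ σ ∈ Icc (0 : ℝ) 1, 2 * √σ + 2 * κ + δ ≤ ‖y σ‖ := fun σ hσ => by
    have h1 := hYfar σ hσ
    have h2 := hyY σ hσ
    have h3 := norm_sub_norm_le (Y σ) (Y σ - y σ)
    rw [sub_sub_cancel, norm_sub_rev] at h3
    linarith
  have hyfar : ∀ σ ∈ Icc (0 : ℝ) 1, FarFrom (shrink μ₀ c) (2 * √σ + 2 * κ) (y σ) := fun σ hσ =>
    FarFrom.of_norm hν (hyn σ hσ)
  let ζ : ℝ → ℂ := fun s => c * y (s / t)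
  have hmaps : MapsTo (fun s : ℝ => s / t) (Icc 0 t) (Icc 0 1) := fun s hs =>
    ⟨div_nonneg hs.1 ht0.le, (div_le_one ht0).2 hs.2⟩
  have hζ0 : ζ 0 = c * z' := by simp [ζ, hy0]
  have hζd : ∀ s ∈ Icc 0 t, HasDerivWithinAt ζ (charField μ₀ s (ζ s)) (Icc 0 t) s := by
    intro s hs
    have h1 : HasDerivWithinAt (fun s : ℝ => s / t) (1 / t) (Icc 0 t) s :=
      ((hasDerivAt_id s).div_const t).hasDerivWithinAt
    have h2 := ((hyd _ (hmaps hs)).scomp s h1 hmaps).const_mul (c : ℂ)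
    refine h2.congr_deriv ?_
    simp only [ζ, charField]
    rw [greenFn_scale hc0, cauchySq_scale hc0]
    have e : 2 * (s : ℂ) * (cauchySq (shrink μ₀ c) (y (s / t)) / c ^ 2)
        = 2 * ((s / t : ℝ) : ℂ) * cauchySq (shrink μ₀ c) (y (s / t)) := by
      rw [← hcc]; push_cast; ring
    rw [e, Complex.real_smul, show ((1 / t : ℝ) : ℂ) = 1 / (c : ℂ) ^ 2 by
      rw [← hcc]; push_cast; ring]
    generalize 1 - 2 * ((s / t : ℝ) : ℂ) * cauchySq (shrink μ₀ c) (y (s / t)) = D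
    generalize greenFn (shrink μ₀ c) (y (s / t)) = N
    field_simp
  have hζfar : ∀ s ∈ Icc 0 t, FarFrom μ₀ (2 * √s + 2 * (c * κ)) (ζ s) := by
    intro s hs
    refine ((hyfar _ (hmaps hs)).scale hc0).mono (le_of_eq ?_)
    rw [Real.sqrt_div hs.1, ← hc]
    field_simp
  obtain ⟨hpathζ, r, hr, hfarγ⟩ := isLoewnerPath_charMap hμ ht0.le (by positivity)
    (by rw [hζ0, Complex.im_ofReal_mul]; positivity) hζd hζfar
  rw [hζ0] at hpathζ
  refine ⟨⟨_, hpathζ⟩, ?_⟩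
  rw [loewnerMap_eq ht0.le hpathζ hr hfarγ]
  have h1m : (1 : ℝ) ∈ Icc (0 : ℝ) 1 := by simp
  have hval : 1 / (c : ℂ) * charMap μ₀ t (ζ t) = charMap (shrink μ₀ c) 1 (y 1) := by
    simp only [charMap, ζ]
    rw [div_self ht0.ne', greenFn_scale hc0, ← hcc]
    push_cast
    field_simp
  have hYne : Y 1 ≠ 0 := by
    rw [← norm_pos_iff]
    have := hYfar 1 h1m
    linarith [Real.sqrt_nonneg 1]
  -- With `sqrtLambert z` equal to $2i/Y_1$ the right-hand side is $Y_1+4/Y_1$.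
  have hlim : 2 * Complex.I * (1 / sqrtLambert z - sqrtLambert z) =
      charMap (Measure.dirac 0) 1 (Y 1) := by
    rw [sqrtLambert_eq hz hz0 hw hwe, ← hY1, charMap, greenFn_dirac]
    field_simp
    push_cast
    linear_combination (-4 : ℂ) * Complex.I_sq
  rw [hval, hlim]
  have hs1 : (0 : ℝ) ≤ √1 := Real.sqrt_nonneg 1
  have hy1n := hyn 1 h1m
  have hY1n := hYfar 1 h1m
  have b1 := hyY 1 h1m
  have b2 := norm_greenFn_sub_dirac_le hκ hν (z := y 1) (by linarith)
  have b3 := norm_greenFn_sub_le (ν := Measure.dirac 0) hκ (a := y 1) (b := Y 1)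
    (farFrom_dirac.2 (by linarith)) (farFrom_dirac.2 (by linarith))
  have e : charMap (shrink μ₀ c) 1 (y 1) - charMap (Measure.dirac 0) 1 (Y 1) =
      (y 1 - Y 1) + 2 * ((greenFn (shrink μ₀ c) (y 1) - greenFn (Measure.dirac 0) (y 1))
        + (greenFn (Measure.dirac 0) (y 1) - greenFn (Measure.dirac 0) (Y 1))) := by
    simp only [charMap]; push_cast; ring
  rw [e]
  have hδη : δ ≤ η' := min_le_right _ _
  calc _ ≤ ‖y 1 - Y 1‖ + ‖(2 : ℂ)‖ *
        (‖greenFn (shrink μ₀ c) (y 1) - greenFn (Measure.dirac 0) (y 1)‖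
        + ‖greenFn (Measure.dirac 0) (y 1) - greenFn (Measure.dirac 0) (Y 1)‖) := by
        refine (norm_add_le _ _).trans ?_
        rw [norm_mul]
        gcongr
        exact norm_add_le _ _
    _ ≤ η' + 2 * (2 / κ ^ 2 * η' + 2 / κ ^ 2 * η') := by
        rw [Complex.norm_ofNat]
        gcongr
        · exact b2.trans (by gcongr)
        · exact b3.trans (by gcongr)
    _ = C * η' := by rw [hC]; ring
    _ ≤ η := hη'C

end Asymptotics

/-! ### The logarithmic potential -/

/-- The complex logarithmic potential, a primitive of `greenFn` in the upper half-plane. -/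
def logPotential (ν : Measure ℝ) (z : ℂ) : ℂ := ∫ u : ℝ, 2 * Complex.log (z - (u : ℂ)) ∂ν

section Potential

variable {ν : Measure ℝ} [IsProbabilityMeasure ν] {L : ℝ} {z : ℂ}

lemma sub_mem_slitPlane (hz : 0 < z.im) (u : ℝ) : z - (u : ℂ) ∈ Complex.slitPlane :=
  Or.inr (by simpa using hz.ne')

lemma integrable_log (hL : ∀ᵐ u : ℝ ∂ν, |u| ≤ L) (hz : 0 < z.im) :
    Integrable (fun u : ℝ => 2 * Complex.log (z - (u : ℂ))) ν := by
  have hc : Continuous fun u : ℝ => 2 * Complex.log (z - (u : ℂ)) :=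
    continuous_const.mul (Continuous.clog (by fun_prop) (sub_mem_slitPlane hz))
  obtain ⟨C, hC⟩ := (isCompact_Icc (a := -L) (b := L)).exists_bound_of_continuousOn hc.continuousOn
  refine Integrable.of_bound (C := C) hc.aestronglyMeasurable ?_
  filter_upwards [hL] with u hu
  exact hC u (abs_le.1 hu)

lemma hasDerivAt_logPotential (hL : ∀ᵐ u : ℝ ∂ν, |u| ≤ L) (hz : 0 < z.im) :
    HasDerivAt (logPotential ν) (greenFn ν z) z := by
  have hball : ∀ w ∈ Metric.ball z (z.im / 2), z.im / 2 ≤ w.im := by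
    intro w hw
    rw [Metric.mem_ball, dist_eq_norm] at hw
    have := (Complex.abs_im_le_norm (w - z)).trans hw.le
    rw [Complex.sub_im, abs_le] at this
    linarith [this.1]
  refine (hasDerivAt_integral_of_dominated_loc_of_deriv_le
    (F := fun w (u : ℝ) => 2 * Complex.log (w - (u : ℂ)))
    (F' := fun w (u : ℝ) => 2 / (w - (u : ℂ))) (bound := fun _ => 2 / (z.im / 2))
    (Metric.ball_mem_nhds z (half_pos hz)) ?_ (integrable_log hL hz) ?_ ?_
    (integrable_const _) ?_).2
  · refine eventually_of_mem (Metric.ball_mem_nhds z (half_pos hz)) fun w hw => ?_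
    exact (integrable_log hL ((half_pos hz).trans_le (hball w hw))).aestronglyMeasurable
  · exact Measurable.aestronglyMeasurable (by fun_prop)
  · refine Eventually.of_forall fun u w hw => ?_
    rw [norm_div, Complex.norm_ofNat]
    have h1 := hball w hw
    have h2 := Complex.abs_im_le_norm (w - (u : ℂ))
    rw [Complex.sub_im, Complex.ofReal_im, sub_zero] at h2
    have h3 := (h1.trans (le_abs_self _)).trans h2
    gcongr
  · refine Eventually.of_forall fun u w hw => ?_
    have h1 := (half_pos hz).trans_le (hball w hw)
    have := (((hasDerivAt_id w).sub_const (u : ℂ)).clog (sub_mem_slitPlane h1 u)).const_mul 2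
    refine this.congr_deriv ?_
    simp; ring

lemma norm_logPotential_sub_le {e d : ℝ} (hd : 0 < d) (hν : ∀ᵐ u : ℝ ∂ν, |u| ≤ e) (hz : 0 < z.im)
    (hn : d + e ≤ ‖z‖) : ‖logPotential ν z - 2 * Complex.log z‖ ≤ 2 / d * e := by
  have e1 : 2 * Complex.log z = ∫ _u : ℝ, 2 * Complex.log z ∂ν := by simp
  rw [e1, logPotential, ← integral_sub (integrable_log hν hz) (integrable_const _)]
  refine norm_integral_le_of_ae_le ?_
  filter_upwards [hν] with u hu
  have he : 0 ≤ e := (abs_nonneg u).trans hu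
  have key := (convex_segment z (z - (u : ℂ))).norm_image_sub_le_of_norm_hasDerivWithin_le
    (f := Complex.log) (f' := fun w => w⁻¹) (C := d⁻¹) (x := z) (y := z - (u : ℂ)) ?_ ?_
    (left_mem_segment ℝ _ _) (right_mem_segment ℝ _ _)
  · rw [sub_sub_cancel_left, norm_neg, Complex.norm_real, Real.norm_eq_abs] at key
    rw [← mul_sub, norm_mul, Complex.norm_ofNat]
    calc 2 * ‖Complex.log (z - u) - Complex.log z‖ ≤ 2 * (d⁻¹ * |u|) := by gcongr
      _ ≤ 2 * (d⁻¹ * e) := by gcongr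
      _ = 2 / d * e := by ring
  · intro w hw
    rw [segment_eq_image'] at hw
    obtain ⟨θ, hθ, rfl⟩ := hw
    refine (Complex.hasStrictDerivAt_log (Or.inr ?_)).hasDerivAt.hasDerivWithinAt
    simp [hz.ne']
  · intro w hw
    rw [segment_eq_image'] at hw
    obtain ⟨θ, hθ, rfl⟩ := hw
    rw [norm_inv]
    refine inv_anti₀ hd ?_
    have h1 := norm_sub_norm_le z (-(θ • (z - (u : ℂ) - z)))
    rw [sub_neg_eq_add, norm_neg, norm_smul, sub_sub_cancel_left, norm_neg, Complex.norm_real,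
      Real.norm_eq_abs, Real.norm_eq_abs, abs_of_nonneg hθ.1] at h1
    have h2 : θ * |u| ≤ 1 * e := mul_le_mul hθ.2 hu (abs_nonneg u) zero_le_one
    rw [sub_sub_cancel_left]
    linarith

lemma logPotential_scale {c : ℝ} (hc : 0 < c) (hL : ∀ᵐ u : ℝ ∂ν, |u| ≤ L) (hz : 0 < z.im) :
    logPotential ν (c * z) = 2 * Real.log c + logPotential (shrink ν c) z := by
  have e1 : (2 * Real.log c : ℂ) = ∫ _u : ℝ, (2 * Real.log c : ℂ) ∂(shrink ν c) := by simp
  rw [e1, logPotential, logPotential, ← integral_add (integrable_const _)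
    (integrable_log (ae_shrink_abs_le hc hL) hz), shrink, (measurableEmbedding_div hc).integral_map]
  congr 1; ext u
  have hc' : (c : ℂ) ≠ 0 := by exact_mod_cast hc.ne'
  have e : (c : ℂ) * z - u = c * (z - ((u / c : ℝ) : ℂ)) := by push_cast; field_simp
  rw [e, Complex.log_ofReal_mul hc (Complex.slitPlane_ne_zero (sub_mem_slitPlane hz _))]
  ring

end Potential

/-! ### Absorption of the interior of $\mathcal K$ -/

section Inside

variable {μ₀ : ProbabilityMeasure ℝ} {μ : ℝ → ProbabilityMeasure ℝ}

/-- The starting point of the characteristic through the end of a Loewner path in the upper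
half-plane, and the conserved quantity of the Loewner flow. -/
lemma IsLoewnerPath.conserved (hμ : IsHydrodynamicLimit μ₀ μ) {L : ℝ}
    (hL : ∀ᵐ u : ℝ ∂(μ₀ : Measure ℝ), |u| ≤ L) {z : ℂ} {T : ℝ} {γ : ℝ → ℂ} (hT : 0 ≤ T)
    (hz : 0 < z.im) (h : IsLoewnerPath μ z T γ) :
    ∃ ζ : ℂ, 0 < ζ.im ∧ 0 < (charMap μ₀ T ζ).im ∧
      T * greenFn μ₀ ζ ^ 2 + logPotential μ₀ ζ = logPotential μ₀ z := by
  have hup := h.upper hz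
  let m : ℝ → ℂ := fun s => greenFn (μ s : Measure ℝ) (γ s)
  -- Tracing the characteristic back to time $0$ only raises the imaginary part, since
  -- $\operatorname{Im}m\le0$; hence no distance condition is needed.
  let ζ : ℝ → ℂ := fun s => γ s - 2 * s * m s
  have hζpos : ∀ s ∈ Icc 0 T, 0 < (ζ s).im := by
    intro s hs
    have h1 := hup s hs
    have h2 : (m s).im = -(γ s).im * poissonInt (μ s : Measure ℝ) (γ s) :=
      greenFn_im (abs_pos.2 h1.ne') (farFrom_im _ _)
    have h3 : (ζ s).im = (γ s).im - 2 * s * (m s).im := by simp [ζ]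
    rw [h3, h2]
    have := poissonInt_nonneg (μ s : Measure ℝ) (γ s)
    have : 0 ≤ 2 * s * ((γ s).im * poissonInt (μ s : Measure ℝ) (γ s)) := by
      have := hs.1
      positivity
    linarith
  have hζγ : ∀ s, ζ s + 2 * s * m s = γ s := fun s => by simp [ζ]
  have hM : ∀ s ∈ Icc 0 T, greenFn μ₀ (ζ s) = m s := by
    intro s hs
    have := greenFn_characteristic hμ (a := ζ s) (b := m s) (T := s) (r₀ := s) ⟨hs.1, le_rfl⟩
      (hζpos s hs) (by rw [hζγ]; exact hup s hs) (by rw [hζγ]) 0 ⟨le_rfl, hs.1⟩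
    simpa [hμ.initial] using this
  have hchar : ∀ s ∈ Icc 0 T, charMap μ₀ s (ζ s) = γ s := fun s hs => by
    rw [charMap, hM s hs, hζγ]
  have hm : ∀ s ∈ Icc 0 T,
      HasDerivWithinAt m (cauchySq (μ s : Measure ℝ) (γ s) * m s) (Icc 0 T) s := fun s hs => by
    refine (hasDerivWithinAt_greenFn_comp hμ Icc_subset_Ici_self hs (h.ode s hs)
      (hup s hs).ne').congr_deriv ?_
    simp only [m]; ring
  -- Here $\zeta'=m-2m-2sm'$ and $\Phi'(\zeta)=m$, so the derivative of $\Phi(\zeta)$ cancels that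
  -- of $sm^2$.
  have hE : ∀ s ∈ Icc 0 T, HasDerivWithinAt
      (fun s : ℝ => (s : ℂ) * m s ^ 2 + logPotential μ₀ (ζ s) - logPotential μ₀ z) 0
      (Icc 0 T) s := by
    intro s hs
    have h1 : HasDerivWithinAt (fun s : ℝ => (s : ℂ)) 1 (Icc 0 T) s :=
      (Complex.ofRealCLM.hasDerivAt (x := s)).hasDerivWithinAt
    have h2 := hm s hs
    have h3 := (h.ode s hs).sub ((h1.const_mul 2).mul h2)
    have h4 := (hasDerivAt_logPotential hL (hζpos s hs)).scomp_hasDerivWithinAt s h3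
    have h5 := ((h1.mul (h2.pow 2)).add h4).sub_const (logPotential μ₀ z)
    refine h5.congr_deriv ?_
    rw [hM s hs]
    simp only [smul_eq_mul, Pi.pow_apply]
    change _ + ((m s - _) * m s) = 0
    push_cast
    ring
  have hT' : T ∈ Icc 0 T := ⟨hT, le_rfl⟩
  have hz0 : ζ 0 = z := by simp [ζ, h.initial]
  have key := eq_zero_of_norm_deriv_le (K := 0) (r₀ := 0) ⟨le_rfl, hT⟩ (by simp [hz0]) hE
    (fun s _ => by simp) T hT'
  refine ⟨ζ T, hζpos T hT', by rw [hchar T hT']; exact hup T hT', ?_⟩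
  rw [hM T hT']
  exact sub_eq_zero.1 key

/-- Survival until time `t` gives $2tP_0(\zeta)<1$ for the Poisson integral at the characteristic
origin $\zeta=\sqrt t\,y$, hence $|\zeta|+L>2\sqrt t$. Half of the rescaled conservation law reads
$2/y^2+\log y=\log z+\delta$ with $\delta=O(1/\sqrt t)$; exponentiating gives the equation for
`outerMap`. -/
lemma exists_outerMap_approx (hμ : IsHydrodynamicLimit μ₀ μ) {L : ℝ} (hL0 : 0 < L)
    (hL : ∀ᵐ u : ℝ ∂(μ₀ : Measure ℝ), |u| ≤ L) {z : ℂ} (hz : 0 < z.im) :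
    ∃ C > 0, ∃ T₀ > 0, ∀ t ≥ T₀, (√t : ℂ) * z ∈ loewnerDomain μ t →
      ∃ y δ : ℂ, 0 ≤ y.im ∧ 2 - C / √t ≤ ‖y‖ ∧ ‖y‖ ≤ C ∧ ‖δ‖ ≤ C / √t ∧
        outerMap y = z * Complex.exp δ := by
  have hz0 : z ≠ 0 := by rintro rfl; simp at hz
  have hzn : 0 < ‖z‖ := norm_pos_iff.2 hz0
  -- Half the total of $8e$ from the squared Green's function and $2e+(4/|z|)e$ from the two
  -- potentials, where $e=L/\sqrt t$. The cap `e₀` keeps `y` and `z` far enough from the rescaled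
  -- measure for these estimates.
  set B : ℝ := 5 + 2 / ‖z‖ with hB
  have hB0 : 0 < B := by positivity
  set e₀ := min (1 / 2) (‖z‖ / 2) with he₀
  have he₀0 : 0 < e₀ := lt_min (by norm_num) (by positivity)
  set R := Real.exp 2 * (‖z‖ * Real.exp (B * e₀)) with hR
  have hR0 : 0 < R := by positivity
  set C := R + B * L + L with hC
  have hC0 : 0 < C := by positivity
  refine ⟨C, hC0, (L / e₀) ^ 2, by positivity, fun t ht hdom => ?_⟩
  have ht0 : 0 < t := lt_of_lt_of_le (by positivity) ht
  set c := √t with hc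
  have hc0 : 0 < c := Real.sqrt_pos.2 ht0
  have hcC : (c : ℂ) ≠ 0 := by exact_mod_cast hc0.ne'
  have hcc : c ^ 2 = t := Real.sq_sqrt ht0.le
  set e := L / c with he
  have he0 : 0 < e := by positivity
  have hee : e ≤ e₀ := by
    rw [he, div_le_comm₀ hc0 he₀0]; exact Real.le_sqrt_of_sq_le ht
  obtain ⟨γ, hγ⟩ := hdom
  have hczim : 0 < ((c : ℂ) * z).im := by rw [Complex.im_ofReal_mul]; positivity
  obtain ⟨ζ, hζ, hF, hcons⟩ := hγ.conserved hμ hL ht0.le hczim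
  set y : ℂ := ζ / c with hy
  have hζy : ζ = c * y := by rw [hy]; field_simp
  have hyim : 0 < y.im := by
    rw [hζy, Complex.im_ofReal_mul] at hζ
    exact (mul_pos_iff_of_pos_left hc0).1 hζ
  have hν := ae_shrink_abs_le hc0 hL
  have hynorm : 2 - e ≤ ‖y‖ := by
    have hfar : FarFrom (μ₀ : Measure ℝ) ζ.im ζ := (farFrom_im _ ζ).mono (le_abs_self _)
    have h1 := greenFn_im hζ hfar
    have h2 : (charMap μ₀ t ζ).im = ζ.im * (1 - 2 * t * poissonInt μ₀ ζ) := by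
      simp only [charMap, Complex.add_im]
      have : (2 * (t : ℂ) * greenFn μ₀ ζ).im = 2 * t * (greenFn μ₀ ζ).im := by simp
      rw [this, h1]; ring
    rw [h2] at hF
    have h3 := (mul_pos_iff_of_pos_left hζ).1 hF
    have h4 := le_poissonInt (D := ‖ζ‖ + L) hζ hfar (by
      filter_upwards [hL] with u hu
      refine (norm_sub_le _ _).trans ?_
      rw [Complex.norm_real, Real.norm_eq_abs]; linarith)
    have hD : 0 < ‖ζ‖ + L := by positivity
    have h5 : 2 * t * (2 / (‖ζ‖ + L) ^ 2) < 1 := by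
      have : 2 * t * (2 / (‖ζ‖ + L) ^ 2) ≤ 2 * t * poissonInt μ₀ ζ := by gcongr
      linarith
    rw [mul_div_assoc', div_lt_one (by positivity)] at h5
    have h6 : 2 * c < ‖ζ‖ + L := by
      refine lt_of_pow_lt_pow_left₀ 2 hD.le ?_
      rw [mul_pow, hcc]; linarith
    have h7 : ‖ζ‖ = c * ‖y‖ := by
      rw [hζy, norm_mul, Complex.norm_real, Real.norm_eq_abs, abs_of_pos hc0]
    have h8 : L = e * c := by rw [he]; field_simp
    rw [h7, h8] at h6
    by_contra hlt
    rw [not_le] at hlt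
    nlinarith
  have he12 : e ≤ 1 / 2 := hee.trans (min_le_left _ _)
  have hez : e ≤ ‖z‖ / 2 := hee.trans (min_le_right _ _)
  have hy1 : 1 + e ≤ ‖y‖ := by linarith
  have hy1' : 1 ≤ ‖y‖ := by linarith
  have hy0 : y ≠ 0 := norm_pos_iff.1 (by linarith)
  have b1 := norm_greenFn_sub_dirac_le one_pos hν hy1
  have b1' := norm_greenFn_le one_pos (FarFrom.of_norm hν hy1)
  have b2 := norm_logPotential_sub_le one_pos hν hyim hy1
  have b3 := norm_logPotential_sub_le (half_pos hzn) hν hz (by linarith)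
  rw [greenFn_dirac] at b1
  set g := greenFn (shrink μ₀ c) y with hg
  have hcons' : g ^ 2 + logPotential (shrink μ₀ c) y = logPotential (shrink μ₀ c) z := by
    rw [hζy, greenFn_scale hc0, logPotential_scale hc0 hL hyim, logPotential_scale hc0 hL hz]
      at hcons
    have e1 : (t : ℂ) * (greenFn (shrink μ₀ c) y / c) ^ 2 = g ^ 2 := by
      rw [← hcc]; push_cast; field_simp; rw [hg]
    rw [e1] at hcons
    linear_combination hcons
  set δ : ℂ := 2 / y ^ 2 + Complex.log y - Complex.log z with hδ
  have h2y : ‖2 / y‖ ≤ 2 := by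
    rw [norm_div, Complex.norm_ofNat, div_le_iff₀ (by linarith)]; linarith
  have hδn : ‖δ‖ ≤ B * e := by
    have e1 : 2 * δ = (2 / y - g) * (2 / y + g)
        - (logPotential (shrink μ₀ c) y - 2 * Complex.log y)
        + (logPotential (shrink μ₀ c) z - 2 * Complex.log z) := by
      rw [hδ, ← hcons']; ring
    have e2 : ‖2 * δ‖ ≤ 2 / 1 ^ 2 * e * (2 + 2 / 1) + 2 / 1 * e + 2 / (‖z‖ / 2) * e := by
      rw [e1]
      refine (norm_add_le _ _).trans (add_le_add ((norm_sub_le _ _).trans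
        (add_le_add ?_ b2)) b3)
      rw [norm_mul, norm_sub_rev]
      exact mul_le_mul b1 ((norm_add_le _ _).trans (add_le_add h2y b1')) (norm_nonneg _)
        (by positivity)
    rw [norm_mul, Complex.norm_ofNat] at e2
    have e3 : 2 / (‖z‖ / 2) * e = 2 * (2 / ‖z‖ * e) := by field_simp
    rw [e3] at e2
    rw [hB]
    linarith
  have hout : outerMap y = z * Complex.exp δ := by
    have : Complex.exp δ = Complex.exp (2 / y ^ 2) * y / z := by
      rw [hδ, Complex.exp_sub, Complex.exp_add, Complex.exp_log hy0, Complex.exp_log hz0]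
    rw [this, outerMap]; field_simp
  have hLc : B * e ≤ C / c := by
    rw [he, mul_div_assoc']
    gcongr
    rw [hC]; linarith
  refine ⟨y, δ, hyim.le, ?_, ?_, hδn.trans hLc, hout⟩
  · have : e ≤ C / c := by
      rw [he]; gcongr; rw [hC]
      have : 0 < B * L := by positivity
      linarith
    linarith
  · have h1 : ‖outerMap y‖ ≤ ‖z‖ * Real.exp (B * e₀) := by
      rw [hout, norm_mul]
      gcongr
      refine (Complex.norm_exp_le_exp_norm δ).trans (Real.exp_le_exp.2 (hδn.trans ?_))
      gcongr
    have h2 : y = outerMap y * Complex.exp (-(2 / y ^ 2)) := by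
      rw [outerMap, mul_assoc, ← Complex.exp_add]; simp
    have h3 : ‖Complex.exp (-(2 / y ^ 2))‖ ≤ Real.exp 2 := by
      refine (Complex.norm_exp_le_exp_norm _).trans (Real.exp_le_exp.2 ?_)
      rw [norm_neg, norm_div, norm_pow, Complex.norm_ofNat, div_le_iff₀ (by positivity)]
      nlinarith
    have h4 : ‖y‖ ≤ R := by
      conv_lhs => rw [h2]
      rw [norm_mul, hR, mul_comm (Real.exp 2)]
      gcongr
    rw [hC]
    have : 0 < B * L := by positivity
    linarith

lemma im_pos_of_mem_interior {z : ℂ} (hz : z ∈ interior universalHull) : 0 < z.im := by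
  refine lt_of_le_of_ne (universalHull_im_nonneg (interior_subset hz)) fun h0 => ?_
  have hc : Continuous fun r : ℝ => z - r * Complex.I := by fun_prop
  have h1 : ∀ᶠ r : ℝ in 𝓝[>] 0, z - r * Complex.I ∈ interior universalHull :=
    nhdsWithin_le_nhds (hc.continuousAt.preimage_mem_nhds
      (isOpen_interior.mem_nhds (by simpa using hz)))
  obtain ⟨r, hr, hr0⟩ := (h1.and self_mem_nhdsWithin).exists
  have h2 := universalHull_im_nonneg (interior_subset hr)
  have hr0 : 0 < r := hr0
  simp [← h0] at h2
  linarith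

/-- Otherwise points `y` along a sequence of times stay bounded, and a limit point of modulus at
least $2$ is mapped by `outerMap` exactly to `z`. -/
lemma eventually_notMem_loewnerDomain (hμ : IsHydrodynamicLimit μ₀ μ) {L : ℝ} (hL0 : 0 < L)
    (hL : ∀ᵐ u : ℝ ∂(μ₀ : Measure ℝ), |u| ≤ L) {z : ℂ} (hz : z ∈ interior universalHull) :
    ∀ᶠ t : ℝ in atTop, (√t : ℂ) * z ∉ loewnerDomain μ t := by
  have hzim := im_pos_of_mem_interior hz
  obtain ⟨C, hC, T₀, hT₀, H⟩ := exists_outerMap_approx hμ hL0 hL hzim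
  by_contra hcon
  rw [not_eventually] at hcon
  have hfreq := hcon.and_eventually (eventually_ge_atTop T₀)
  obtain ⟨τ, hτ, hp⟩ := exists_seq_forall_of_frequently hfreq
  have hp' : ∀ n, ∃ y δ : ℂ, 0 ≤ y.im ∧ 2 - C / √(τ n) ≤ ‖y‖ ∧ ‖y‖ ≤ C ∧ ‖δ‖ ≤ C / √(τ n) ∧
      outerMap y = z * Complex.exp δ := fun n => H _ (hp n).2 (not_not.1 (hp n).1)
  choose y δ hyim hylow hyup hδ hout using hp'
  have hlim : Tendsto (fun n => C / √(τ n)) atTop (𝓝 0) :=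
    (Real.tendsto_sqrt_atTop.comp hτ).const_div_atTop C
  have hδ0 : Tendsto δ atTop (𝓝 0) := squeeze_zero_norm hδ hlim
  obtain ⟨a, -, φ, hφ, ha⟩ := (isCompact_closedBall (0 : ℂ) C).tendsto_subseq
    (x := y) (fun n => by simpa using hyup n)
  have ha2 : 2 ≤ ‖a‖ := by
    have h1 : Tendsto (fun n => 2 - C / √(τ (φ n))) atTop (𝓝 (2 - 0)) :=
      (hlim.comp hφ.tendsto_atTop).const_sub 2
    rw [sub_zero] at h1
    exact le_of_tendsto_of_tendsto' h1 ha.norm fun n => hylow (φ n)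
  have haim : 0 ≤ a.im :=
    ge_of_tendsto' ((Complex.continuous_im.tendsto a).comp ha) fun n => hyim (φ n)
  have ha0 : a ≠ 0 := norm_pos_iff.1 (by linarith)
  have hc : ContinuousAt outerMap a := by
    unfold outerMap
    exact ContinuousAt.mul continuousAt_id (ContinuousAt.cexp (ContinuousAt.div₀ continuousAt_const
      (by fun_prop) (pow_ne_zero 2 ha0)))
  have h1 : Tendsto (fun n => outerMap (y (φ n))) atTop (𝓝 (outerMap a)) := hc.tendsto.comp ha
  have h2 : Tendsto (fun n => outerMap (y (φ n))) atTop (𝓝 z) := by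
    simp only [hout]
    have h3 : Tendsto (fun n => z * Complex.exp (δ (φ n))) atTop (𝓝 (z * Complex.exp 0)) :=
      ((Complex.continuous_exp.tendsto 0).comp (hδ0.comp hφ.tendsto_atTop)).const_mul z
    simpa using h3
  have h4 := tendsto_nhds_unique h1 h2
  exact outerMap_notMem_interior haim ha2 (h4 ▸ hz)

end Inside

end MultipleSLE

end

/-! ### Assembly -/

theorem theorem5p2 (μ₀ : ProbabilityMeasure ℝ)
    (hμ₀ : ∃ L : ℝ, 0 < L ∧ (μ₀ : Measure ℝ).support ⊆ Icc (-L) L)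
    (μ : ℝ → ProbabilityMeasure ℝ) (hμ : MultipleSLE.IsHydrodynamicLimit μ₀ μ) :
    (∀ z : ℂ, 0 ≤ z.im → z ∉ MultipleSLE.universalHull →
      (∀ᶠ t : ℝ in atTop, (√t : ℂ) * z ∈ MultipleSLE.loewnerDomain μ t) ∧
      Tendsto (fun t : ℝ => 1 / (√t : ℂ) * MultipleSLE.loewnerMap μ t ((√t : ℂ) * z)) atTop
        (𝓝 (2 * Complex.I *
          (1 / MultipleSLE.sqrtLambert z - MultipleSLE.sqrtLambert z)))) ∧
    (∀ z : ℂ, 0 ≤ z.im → z ∉ MultipleSLE.universalHull →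
      ∀ᶠ t : ℝ in atTop, (√t : ℂ) * z ∉ MultipleSLE.hull μ t) ∧
    (∀ z ∈ interior MultipleSLE.universalHull,
      ∀ᶠ t : ℝ in atTop, (√t : ℂ) * z ∈ MultipleSLE.hull μ t) := by
  obtain ⟨L, hL0, hsupp⟩ := hμ₀
  have hL : ∀ᵐ u : ℝ ∂(μ₀ : Measure ℝ), |u| ≤ L := by
    filter_upwards [Measure.support_mem_ae (μ := (μ₀ : Measure ℝ))] with u hu
    exact abs_le.2 (hsupp hu)
  refine ⟨fun z hz hzK => ⟨?_, ?_⟩, fun z hz hzK => ?_, fun z hz => ?_⟩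
  · obtain ⟨δ, hδ, T₀, -, H⟩ := MultipleSLE.loewner_outside hμ hL hz hzK one_pos
    filter_upwards [eventually_ge_atTop T₀] with t ht
    exact (H t ht z hz (by simpa using hδ.le)).1
  · rw [Metric.tendsto_nhds]
    intro ε hε
    obtain ⟨δ, hδ, T₀, -, H⟩ := MultipleSLE.loewner_outside hμ hL hz hzK (half_pos hε)
    filter_upwards [eventually_ge_atTop T₀] with t ht
    rw [dist_eq_norm]
    exact ((H t ht z hz (by simpa using hδ.le)).2).trans_lt (half_lt_self hε)
  · obtain ⟨δ, hδ, T₀, hT₀, H⟩ := MultipleSLE.loewner_outside hμ hL hz hzK one_pos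
    filter_upwards [eventually_ge_atTop T₀] with t ht hmem
    have hc0 : 0 < √t := Real.sqrt_pos.2 (hT₀.trans_le ht)
    have hcC : (√t : ℂ) ≠ 0 := by exact_mod_cast hc0.ne'
    rw [MultipleSLE.hull, Metric.mem_closure_iff] at hmem
    -- The hull is a closure, so membership gives a lost point within $\sqrt t\,\delta$ of $\sqrt
    -- t\,z$; after rescaling it is within `δ` of `z`, where the uniform statement forbids it.
    obtain ⟨w, ⟨hwim, hwdom⟩, hw⟩ := hmem (√t * δ) (by positivity)
    have hwim : 0 < w.im := hwim
    have e : w = (√t : ℂ) * (w / √t) := by field_simp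
    apply hwdom
    rw [e]
    refine (H t ht (w / √t) ?_ ?_).1
    · rw [Complex.div_ofReal_im]; positivity
    · rw [dist_eq_norm, norm_sub_rev] at hw
      have e2 : w / √t - z = (w - √t * z) / √t := by field_simp
      rw [e2, norm_div, Complex.norm_real, Real.norm_eq_abs, abs_of_pos hc0, div_le_iff₀ hc0]
      linarith
  · filter_upwards [MultipleSLE.eventually_notMem_loewnerDomain hμ hL0 hL hz,
      eventually_gt_atTop 0] with t ht ht0
    refine subset_closure ⟨?_, ht⟩
    change 0 < ((√t : ℂ) * z).im
    rw [Complex.im_ofReal_mul]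
    have := MultipleSLE.im_pos_of_mem_interior hz
    have := Real.sqrt_pos.2 ht0
    positivity
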